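/- For a finite alphabet $\Sigma$ and words $u,v\in\Sigma^*$ write $u\le_{\mathrm{pref}}v$ if $u$ is a prefix of $v$. A DFA is a tuple $\mathcal A=(Q,\Sigma,\delta,q_0,F)$ with finite sets $Q$ (states) and $\Sigma$ (input alphabet), a partial transition map $\delta:Q\times\Sigma\rightharpoonup Q$, an initial state $q_0\in Q$ and a set $F\subseteq Q$ of final states; $L(\mathcal A)\subseteq\Sigma^*$ is the language it accepts. **Theorem.** The following problem can be solved in (deterministic) polynomial time. INPUT: Two DFAs $\mathcal A_1$ and $\mathcal A_2$ (whose alphabets are part of the input and may be different) such that $\varepsilon\in L(\mathcal A_1)\cap L(\mathcal A_2)$. QUESTION: Are the trees $(L(\mathcal A_1);\le_{\mathrm{pref}})$ and $(L(\mathcal A_2);\le_{\mathrm{pref}})$ isomorphic as partially ordered sets? That is, there are a deterministic Turing machine $M$ and a polynomial $p$ such that, for every such pair $(\mathcal A_1,\mathcal A_2)$, $M$ started on the standard encoding $w$ of the pair (state sets $\{0,\dots,n_i-1\}$, alphabets $\{0,\dots,k_i-1\}$, initial states, final states and full transition tables, all written as a bit string) halts after at most $p(|w|)$ steps with the correct yes/no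 answer. -/

import Mathlib

namespace RegularTree

/-- A deterministic finite automaton with a partial transition map, in the form in which it is
handed to an algorithm: states `0, …, numStates - 1`, input symbols `0, …, numSymbols - 1`.
The alphabet is part of the automaton, so it is not fixed and may differ between automata. -/
structure PartialDFA where
  numStates : ℕ
  numSymbols : ℕ
  step : Fin numStates → Fin numSymbols → Option (Fin numStates)
  start : Fin numStates
  accept : Finset (Fin numStates)

namespace PartialDFA

/-- The state reached from `q` by reading a word, if all transitions needed are defined. -/
def evalFrom (A : PartialDFA) : Fin A.numStates → List (Fin A.numSymbols) → Option (Fin A.numStates)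
  | q, [] => some q
  | q, a :: w => (A.step q a).bind fun p => A.evalFrom p w

/-- The accepted language. -/
def language (A : PartialDFA) : Language (Fin A.numSymbols) :=
  {w | ∃ q ∈ A.accept, A.evalFrom A.start w = some q}

/-- The prefix order on the accepted language. -/
def prefixOrder (A : PartialDFA) (u v : {w // w ∈ A.language}) : Prop :=
  (u : List (Fin A.numSymbols)) <+: (v : List (Fin A.numSymbols))

/-- The two languages, ordered by the prefix order, are isomorphic as partial orders. -/
def PrefixIso (A B : PartialDFA) : Prop :=
  Nonempty (A.prefixOrder ≃r B.prefixOrder)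

/-- A transition table entry as a number: `0` for "undefined", `p + 1` for the state `p`. -/
def entry {n : ℕ} : Option (Fin n) → ℕ
  | none => 0
  | some p => p.val + 1

/-- The description of an automaton as a sequence of numbers: the number of states, the number of
symbols, the initial state, one `0`/`1` flag for each state (is it final?), and the transition
table row by row. -/
def toNats (A : PartialDFA) : List ℕ :=
  A.numStates :: A.numSymbols :: A.start.val ::
    ((List.finRange A.numStates).map (fun q => if q ∈ A.accept then 1 else 0) ++
      (List.finRange A.numStates).flatMap fun q =>
        (List.finRange A.numSymbols).map fun a => entry (A.step q a))

end PartialDFA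

/-- A sequence of numbers as a bit string; `m` is written as `m` ones followed by a zero. -/
def natsToBits (l : List ℕ) : List Bool :=
  l.flatMap fun m => List.replicate m true ++ [false]

/-- The instances: pairs of automata that both accept the empty word. -/
def Instance : Type :=
  {x : PartialDFA × PartialDFA // [] ∈ x.1.language ∧ [] ∈ x.2.language}

/-- The bit string that describes an instance. For `n` states and `k` symbols, each automaton
contributes `3 + n + n * k` numbers, each of them at most `max n k`; so writing the numbers in
unary or in binary makes only a polynomial difference to the length. -/
def Instance.encode (x : Instance) : List Bool :=
  natsToBits (x.1.1.toNats ++ x.1.2.toNats)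

/-- The decision problem `P` on the type `α` of instances, described by words through `enc`, can
be solved in polynomial time: a deterministic multi-stack Turing machine, started on the
description of any instance, halts with the correct answer after a number of steps that is bounded
by a polynomial in the length of the description. -/
def SolvableInPolyTime {α Γ : Type} (enc : α → List Γ) (P : α → Prop) : Prop :=
  ∃ f : α → Bool, (∀ x, f x = true ↔ P x) ∧
    Nonempty (Turing.TM2ComputableInPolyTime enc Computability.encodeBool f)

/-! The encoding determines the instance. -/

theorem natsToBits_injective : Function.Injective natsToBits := by
  have key : ∀ (m n : ℕ) (s t : List Bool),
      List.replicate m true ++ false :: s = List.replicate n true ++ false :: t →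
        m = n ∧ s = t := by
    intro m
    induction m with
    | zero => intro n s t h; cases n <;> simp_all [List.replicate_succ]
    | succ m ih =>
      intro n s t h
      cases n with
      | zero => simp [List.replicate_succ] at h
      | succ n =>
        simp only [List.replicate_succ, List.cons_append, List.cons.injEq, true_and] at h
        have := ih n s t h
        exact ⟨by omega, this.2⟩
  intro l
  induction l with
  | nil => intro l' h; cases l' <;> simp_all [natsToBits]
  | cons m l ih =>
    intro l' h
    cases l' with
    | nil => simp [natsToBits] at h
    | cons m' l' =>
      simp only [natsToBits, List.flatMap_cons, List.append_assoc, List.cons_append,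
        List.nil_append] at h
      obtain ⟨h1, h2⟩ := key _ _ _ _ h
      rw [h1, ih h2]

theorem PartialDFA.entry_injective {n : ℕ} : Function.Injective (PartialDFA.entry (n := n)) := by
  intro a b h
  cases a <;> cases b <;> simp_all [PartialDFA.entry, Fin.ext_iff]

theorem PartialDFA.toNats_append {A B : PartialDFA} {s t : List ℕ}
    (h : A.toNats ++ s = B.toNats ++ t) : A = B ∧ s = t := by
  obtain ⟨n, k, d, i, F⟩ := A
  obtain ⟨n', k', d', i', F'⟩ := B
  simp only [toNats, List.cons_append, List.cons.injEq, List.append_assoc] at h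
  obtain ⟨rfl, rfl, hi, h⟩ := h
  obtain ⟨hF, h⟩ := List.append_inj h (by simp)
  obtain ⟨hd, hst⟩ := List.append_inj h (by simp [List.length_flatMap])
  refine ⟨?_, hst⟩
  obtain rfl : i = i' := Fin.ext hi
  have h1 : F = F' := by
    ext q
    have := (List.map_inj_left.1 hF) q (List.mem_finRange q)
    split_ifs at this <;> simp_all
  have h2 : d = d' := by
    have rows : ∀ l : List (Fin n),
        (l.flatMap fun q => (List.finRange k).map fun a => entry (d q a)) =
          (l.flatMap fun q => (List.finRange k).map fun a => entry (d' q a)) →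
        ∀ q ∈ l, ∀ a, d q a = d' q a := by
      intro l
      induction l with
      | nil => simp
      | cons q l ih =>
        intro h
        simp only [List.flatMap_cons] at h
        obtain ⟨ha, hb⟩ := List.append_inj h (by simp)
        intro p hp a
        rcases List.mem_cons.1 hp with rfl | hp
        · exact entry_injective ((List.map_inj_left.1 ha) a (List.mem_finRange a))
        · exact ih hb p hp a
    funext q a
    exact rows _ hd q (List.mem_finRange q) a
  rw [h1, h2]

theorem Instance.encode_injective : Function.Injective Instance.encode := by
  intro x y h
  obtain ⟨h1, h2⟩ := PartialDFA.toNats_append (natsToBits_injective h)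
  have h3 := (PartialDFA.toNats_append (s := []) (t := []) (by simpa using h2)).1
  exact Subtype.ext (Prod.ext h1 h3)

end RegularTree

/-!
The tree of the words accepted from a final state `v` of a deterministic automaton is determined by
the *children* of its root, which are the minimal nonempty accepted words: reading a child `c` leads
to a final state `p`, and the subtree above `c` is the tree of `p`. So an isomorphism between the
trees of two final states `v` and `v'` matches the children of `v` with those of `v'` in such a way
that matching children lead to states with isomorphic trees (`PartialAutomaton.child_relIso`).
Conversely, let `E` be an equivalence relation on the states such that equivalent states have
equally many children in each class of `E`. The numbers of children are in `ℕ ∪ {∞}`, and since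
there are only countably many words, the children of equivalent states can be matched class by
class. Applying these matchings along the paths of the tree yields an isomorphism between the trees
of equivalent final states (`PartialAutomaton.treeIso_of_stable`). Hence, on final states,
isomorphism of trees is the coarsest stable equivalence relation, and partition refinement reaches
it after at most `N ^ 2` rounds, `N` being the number of states
(`PartialAutomaton.treeIso_iff_refinement`). For two automata, the refinement is applied to their
disjoint union (`prefixIso_iff_treeIso`).

Each round needs the number of children of a state that lead to a given class. By the pumping lemma
this number is infinite if and only if there is such a child of length between `N + 2` and
`2 * N + 2`; otherwise all such children have length at most `N + 1`
(`PartialAutomaton.encard_childSet`). The numbers of words of bounded length satisfy a simple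
recursion. They may be exponentially large, but have polynomially many binary digits, so they are
computed in binary with a fixed number of digits (`Represents.signature_eq_iff`).

For the running time, values of all types that occur are represented by binary trees, whose prefix
codes are kept on a stack. A function is in the class `PolyTime` if some structured program on four
stacks replaces the code of the argument by that of the value in polynomially many steps. This class
is closed under composition, pairing, case distinction, and folding over a list with intermediate
results of polynomial size (`PolyTime.foldl`), and the algorithm is assembled from these operations
(`polyTime_decideIso`). The structured programs are compiled to the multi-stack Turing machines of
Mathlib (`Run.reaches`, `solvableInPolyTime_of_polyTime`).
-/

/-! ### Structured programs on four stacks -/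

namespace RegularTree

open Turing

/-- The names of the four stacks of a stack program. -/
inductive Stack | main | aux | tmp | count
  deriving DecidableEq

instance : Fintype Stack :=
  ⟨{.main, .aux, .tmp, .count}, fun k => by cases k <;> simp⟩

/-- Structured programs that manipulate four stacks of bits and one register, which holds the
result of the last `pop` (`none` if the stack was empty). The program `cases pn pf pt` branches on
the register being `none`, `some false` or `some true`, and `loop c p` repeats `p` as long as the
register satisfies `c`. -/
inductive Prog
  | skip
  | push (k : Stack) (b : Bool)
  | pop (k : Stack)
  | seq (p q : Prog)
  | cases (pn pf pt : Prog)
  | loop (c : Option Bool → Bool) (p : Prog)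

/-- The contents of the four stacks. -/
def stk (s a b c : List Bool) : Stack → List Bool
  | .main => s
  | .aux => a
  | .tmp => b
  | .count => c

@[simp] theorem stk_main (s a b c) : stk s a b c .main = s := rfl
@[simp] theorem stk_aux (s a b c) : stk s a b c .aux = a := rfl
@[simp] theorem stk_tmp (s a b c) : stk s a b c .tmp = b := rfl
@[simp] theorem stk_count (s a b c) : stk s a b c .count = c := rfl
@[simp] theorem update_stk_main (s a b c x) :
    Function.update (stk s a b c) .main x = stk x a b c := by
  funext k; cases k <;> rfl
@[simp] theorem update_stk_aux (s a b c x) :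
    Function.update (stk s a b c) .aux x = stk s x b c := by
  funext k; cases k <;> rfl
@[simp] theorem update_stk_tmp (s a b c x) :
    Function.update (stk s a b c) .tmp x = stk s a x c := by
  funext k; cases k <;> rfl
@[simp] theorem update_stk_count (s a b c x) :
    Function.update (stk s a b c) .count x = stk s a b x := by
  funext k; cases k <;> rfl

/-- `Run p r S r' S' t`: the program `p`, started with register `r` and stacks `S`, terminates with
register `r'` and stacks `S'` after at most `t` steps. -/
inductive Run : Prog → Option Bool → (Stack → List Bool) →
    Option Bool → (Stack → List Bool) → ℕ → Prop
  | skip {r S} : Run .skip r S r S 1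
  | push {k b r S} : Run (.push k b) r S r (Function.update S k (b :: S k)) 1
  | pop {k r S} : Run (.pop k) r S (S k).head? (Function.update S k (S k).tail) 1
  | seq {p q r S r₁ S₁ r₂ S₂ t₁ t₂} : Run p r S r₁ S₁ t₁ → Run q r₁ S₁ r₂ S₂ t₂ →
      Run (.seq p q) r S r₂ S₂ (t₁ + t₂)
  | casesNone {pn pf pt S r' S' t} : Run pn none S r' S' t →
      Run (.cases pn pf pt) none S r' S' (t + 1)
  | casesFalse {pn pf pt S r' S' t} : Run pf (some false) S r' S' t →
      Run (.cases pn pf pt) (some false) S r' S' (t + 1)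
  | casesTrue {pn pf pt S r' S' t} : Run pt (some true) S r' S' t →
      Run (.cases pn pf pt) (some true) S r' S' (t + 1)
  | loopTrue {c p r S r₁ S₁ r₂ S₂ t₁ t₂} : c r = true → Run p r S r₁ S₁ t₁ →
      Run (.loop c p) r₁ S₁ r₂ S₂ t₂ → Run (.loop c p) r S r₂ S₂ (t₁ + t₂ + 1)
  | loopFalse {c p r S} : c r = false → Run (.loop c p) r S r S 1
  | weaken {p r S r' S' t t'} : Run p r S r' S' t → t ≤ t' → Run p r S r' S' t'

/-! ### Compilation to multi-stack Turing machines -/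

namespace Prog

/-- The labels needed to run a program on a multi-stack machine. -/
def Label : Prog → Type
  | skip => Unit
  | push _ _ => Unit
  | pop _ => Unit
  | seq p q => Label p ⊕ Label q
  | cases pn pf pt => Option (Label pn ⊕ Label pf ⊕ Label pt)
  | loop _ p => Option (Label p)

/-- The set of labels of a program is finite. -/
@[reducible]
def fintypeLabel : (p : Prog) → Fintype p.Label
  | skip => inferInstanceAs (Fintype Unit)
  | push _ _ => inferInstanceAs (Fintype Unit)
  | pop _ => inferInstanceAs (Fintype Unit)
  | seq p q => @instFintypeSum _ _ (fintypeLabel p) (fintypeLabel q)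
  | cases pn pf pt => @instFintypeOption _ (@instFintypeSum _ _ (fintypeLabel pn)
      (@instFintypeSum _ _ (fintypeLabel pf) (fintypeLabel pt)))
  | loop _ p => @instFintypeOption _ (fintypeLabel p)

/-- The label at which a program starts. -/
def entry : (p : Prog) → p.Label
  | skip => ()
  | push _ _ => ()
  | pop _ => ()
  | seq p _ => .inl (entry p)
  | cases _ _ _ => none
  | loop _ _ => none

/-- The statement at each label, if the labels of the program are embedded into those of a machine
by `emb` and control passes to the label `exit` at the end. -/
def compile {Λ : Type} : (p : Prog) → (p.Label → Λ) → Λ → p.Label →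
    TM2.Stmt (fun _ : Stack => Bool) Λ (Option Bool)
  | skip, _, exit, _ => .goto fun _ => exit
  | push k b, _, exit, _ => .push k (fun _ => b) (.goto fun _ => exit)
  | pop k, _, exit, _ => .pop k (fun _ o => o) (.goto fun _ => exit)
  | seq p q, emb, _, .inl l => compile p (fun l => emb (.inl l)) (emb (.inr (entry q))) l
  | seq _ q, emb, exit, .inr l => compile q (fun l => emb (.inr l)) exit l
  | cases pn pf pt, emb, _, none => .goto fun r => match r with
      | none => emb (some (.inl (entry pn)))
      | some false => emb (some (.inr (.inl (entry pf))))
      | some true => emb (some (.inr (.inr (entry pt))))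
  | cases pn _ _, emb, exit, some (.inl l) =>
      compile pn (fun l => emb (some (.inl l))) exit l
  | cases _ pf _, emb, exit, some (.inr (.inl l)) =>
      compile pf (fun l => emb (some (.inr (.inl l)))) exit l
  | cases _ _ pt, emb, exit, some (.inr (.inr l)) =>
      compile pt (fun l => emb (some (.inr (.inr l)))) exit l
  | loop c p, emb, exit, none => .goto fun r => bif c r then emb (some (entry p)) else exit
  | loop _ p, emb, _, some l => compile p (fun l => emb (some l)) (emb none) l

end Prog

/-- Running a compiled program on a machine that contains it. -/
theorem Run.reaches {p : Prog} {r S r' S' t} (h : Run p r S r' S' t) :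
    ∀ {Λ : Type} (M : Λ → TM2.Stmt (fun _ : Stack => Bool) Λ (Option Bool)) (emb : p.Label → Λ)
      (exit : Λ), (∀ l, M (emb l) = p.compile emb exit l) →
      ∃ n ≤ t, (flip bind (TM2.step M))^[n] (some ⟨some (emb p.entry), r, S⟩) =
        some ⟨some exit, r', S'⟩ := by
  -- One step from `a` to `b`, then a computation from `b`.
  have one : ∀ {Λ : Type} (M : Λ → TM2.Stmt (fun _ : Stack => Bool) Λ (Option Bool))
      {a b : TM2.Cfg (fun _ : Stack => Bool) Λ (Option Bool)} {c} {t : ℕ},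
      TM2.step M a = some b → (∃ n ≤ t, (flip bind (TM2.step M))^[n] (some b) = c) →
      ∃ n ≤ t + 1, (flip bind (TM2.step M))^[n] (some a) = c := by
    rintro Λ M a b c t hab ⟨n, hn, h⟩
    refine ⟨n + 1, by omega, ?_⟩
    rw [Function.iterate_succ_apply, ← h, ← hab]
    rfl
  induction h with
  | skip =>
    intro Λ M emb exit hM
    exact one M (by simp [hM, Prog.compile, TM2.step, TM2.stepAux]) ⟨0, le_rfl, rfl⟩
  | push =>
    intro Λ M emb exit hM
    exact one M (by simp [hM, Prog.compile, TM2.step, TM2.stepAux]) ⟨0, le_rfl, rfl⟩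
  | pop =>
    intro Λ M emb exit hM
    exact one M (by simp [hM, Prog.compile, TM2.step, TM2.stepAux]) ⟨0, le_rfl, rfl⟩
  | @seq p q _ _ _ _ _ _ _ _ _ _ ih₁ ih₂ =>
    intro Λ M emb exit hM
    obtain ⟨n₁, h₁, e₁⟩ := ih₁ M (fun l => emb (.inl l)) (emb (.inr q.entry))
      (fun l => hM (.inl l))
    obtain ⟨n₂, h₂, e₂⟩ := ih₂ M (fun l => emb (.inr l)) exit (fun l => hM (.inr l))
    refine ⟨n₂ + n₁, by omega, ?_⟩
    rw [Function.iterate_add_apply]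
    exact (congrArg _ e₁).trans e₂
  | @casesNone pn pf pt _ _ _ _ _ ih =>
    intro Λ M emb exit hM
    exact one M ((congrArg (fun q => some (TM2.stepAux q _ _)) (hM none)).trans rfl)
      (ih M (fun l => emb (some (.inl l))) exit (fun l => hM (some (.inl l))))
  | @casesFalse pn pf pt _ _ _ _ _ ih =>
    intro Λ M emb exit hM
    exact one M ((congrArg (fun q => some (TM2.stepAux q _ _)) (hM none)).trans rfl)
      (ih M (fun l => emb (some (.inr (.inl l)))) exit (fun l => hM (some (.inr (.inl l)))))
  | @casesTrue pn pf pt _ _ _ _ _ ih =>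
    intro Λ M emb exit hM
    exact one M ((congrArg (fun q => some (TM2.stepAux q _ _)) (hM none)).trans rfl)
      (ih M (fun l => emb (some (.inr (.inr l)))) exit (fun l => hM (some (.inr (.inr l)))))
  | @loopTrue c p r S _ _ _ _ _ _ hc _ _ ih₁ ih₂ =>
    intro Λ M emb exit hM
    obtain ⟨n₁, h₁, e₁⟩ := ih₁ M (fun l => emb (some l)) (emb none) (fun l => hM (some l))
    obtain ⟨n₂, h₂, e₂⟩ := ih₂ M emb exit hM
    refine one M (b := ⟨some (emb (some p.entry)), r, S⟩) ?_ ⟨n₂ + n₁, by omega, ?_⟩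
    · exact (congrArg (fun q => some (TM2.stepAux q _ _)) (hM none)).trans
        (by simp [Prog.compile, hc])
    · rw [Function.iterate_add_apply, e₁]
      exact e₂
  | loopFalse hc =>
    intro Λ M emb exit hM
    exact one M ((congrArg (fun q => some (TM2.stepAux q _ _)) (hM none)).trans
      (by simp [Prog.compile, hc])) ⟨0, le_rfl, rfl⟩
  | weaken _ hle ih =>
    intro Λ M emb exit hM
    obtain ⟨n, hn, e⟩ := ih M emb exit hM
    exact ⟨n, hn.trans hle, e⟩

/-- The machine of a program; the input is given on the stack `aux`, the output is delivered on the
stack `tmp`. The additional label `none` resets the register and halts. -/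
def Prog.machine (p : Prog) : FinTM2 where
  K := Stack
  k₀ := .aux
  k₁ := .tmp
  Γ _ := Bool
  Λ := Option p.Label
  main := some p.entry
  ΛFin := @instFintypeOption _ p.fintypeLabel
  σ := Option Bool
  initialState := none
  Γk₀Fin := inferInstanceAs (Fintype Bool)
  m
    | none => .load (fun _ => none) .halt
    | some l => p.compile some none l

/-- A decision problem is solvable in polynomial time if a stack program solves it. -/
theorem solvableInPolyTime_of_run {α : Type} {enc : α → List Bool} {P : α → Prop} (p : Prog)
    (T : Polynomial ℕ) (f : α → Bool) (hf : ∀ x, f x = true ↔ P x)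
    (h : ∀ x, ∃ r, Run p none (stk [] (enc x) [] []) r (stk [] [] [f x] [])
      (T.eval (enc x).length)) :
    SolvableInPolyTime enc P := by
  refine ⟨f, hf, ⟨⟨⟨p.machine, Equiv.refl Bool, Equiv.refl Bool⟩, T + 1, fun x => ?_⟩⟩⟩
  have map_id (l : List Bool) : l.map (Equiv.refl Bool).invFun = l := List.map_id l
  have key : ∃ n ≤ (T + 1).eval (enc x).length,
      (flip bind p.machine.step)^[n]
          (some (initList p.machine ((enc x).map (Equiv.refl Bool).invFun))) =
        some (haltList p.machine
          ((Computability.encodeBool (f x)).map (Equiv.refl Bool).invFun)) := by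
    obtain ⟨r, hr⟩ := h x
    obtain ⟨n, hn, e⟩ := hr.reaches p.machine.m some none (fun l => rfl)
    refine ⟨n + 1, by simpa using hn, ?_⟩
    have h0 : initList p.machine ((enc x).map (Equiv.refl Bool).invFun) =
        (⟨some (some p.entry), none, stk [] (enc x) [] []⟩ : TM2.Cfg _ _ _) := by
      unfold initList
      congr 1
      funext k
      cases k
      · rfl
      · exact map_id _
      · rfl
      · rfl
    have h1 : haltList p.machine
        ((Computability.encodeBool (f x)).map (Equiv.refl Bool).invFun) =
        (⟨none, none, stk [] [] [f x] []⟩ : TM2.Cfg _ _ _) := by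
      unfold haltList
      congr 1
      funext k
      cases k
      · rfl
      · rfl
      · exact map_id _
      · rfl
    rw [Function.iterate_succ_apply', h0, h1]
    exact (congrArg (flip bind p.machine.step) e).trans rfl
  exact ⟨⟨key.choose, key.choose_spec.2⟩, key.choose_spec.1⟩

end RegularTree

/-! ### Executions of basic programs -/

namespace RegularTree

/-- `Exec p S S' t`: started with stacks `S` and any register, `p` terminates with stacks `S'` after
at most `t` steps. -/
def Exec (p : Prog) (S S' : Stack → List Bool) (t : ℕ) : Prop :=
  ∀ r, ∃ r', Run p r S r' S' t

namespace Exec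

variable {p q pn pf pt : Prog} {S S₁ S₂ S' : Stack → List Bool} {t t₁ t₂ : ℕ} {k l : Stack}

theorem weaken (h : Exec p S S' t₁) (hle : t₁ ≤ t₂) : Exec p S S' t₂ := fun r =>
  (h r).imp fun _ hr => hr.weaken hle

theorem of_eq (h : Exec p S₁ S₂ t₁) (e₁ : S₁ = S) (e₂ : S₂ = S') (hle : t₁ ≤ t) :
    Exec p S S' t := e₁ ▸ e₂ ▸ h.weaken hle

theorem skip : Exec .skip S S 1 := fun _ => ⟨_, .skip⟩

theorem push {b : Bool} : Exec (.push k b) S (Function.update S k (b :: S k)) 1 :=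
  fun _ => ⟨_, .push⟩

theorem seq (h₁ : Exec p S S₁ t₁) (h₂ : Exec q S₁ S₂ t₂) : Exec (.seq p q) S S₂ (t₁ + t₂) := by
  intro r
  obtain ⟨r₁, h₁⟩ := h₁ r
  obtain ⟨r₂, h₂⟩ := h₂ r₁
  exact ⟨r₂, h₁.seq h₂⟩

end Exec

namespace Prog

/-- Pop a bit and branch on the result. -/
def branch (k : Stack) (pf pt : Prog) : Prog :=
  .seq (.pop k) (.cases .skip pf pt)

/-- Repeat: pop a bit, leave the loop if the result does not satisfy `c`, and run `p`. -/
def popLoop (k : Stack) (c : Option Bool → Bool) (p : Prog) : Prog :=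
  .seq (.pop k) (.loop c (.seq p (.pop k)))

/-- Empty the stack `k`. -/
def clear (k : Stack) : Prog :=
  popLoop k Option.isSome .skip

/-- Move all bits of the stack `k` to the stack `l`, which reverses their order. -/
def pour (k l : Stack) : Prog :=
  popLoop k Option.isSome (.cases .skip (.push l false) (.push l true))

/-- Move all bits of the stack `aux` to both `main` and `tmp`. -/
def pourBoth : Prog :=
  popLoop .aux Option.isSome (.cases .skip (.seq (.push .main false) (.push .tmp false))
    (.seq (.push .main true) (.push .tmp true)))

end Prog

namespace Exec

variable {p q pn pf pt : Prog} {S S₁ S₂ S' : Stack → List Bool} {t t₁ t₂ : ℕ} {k l : Stack}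

theorem branch_false {s : List Bool} (hS : S k = false :: s)
    (h : Exec pf (Function.update S k s) S' t) : Exec (.branch k pf pt) S S' (t + 2) := by
  intro r
  obtain ⟨r', h⟩ := h (some false)
  refine ⟨r', ?_⟩
  have h1 : Run (.pop k) r S (some false) (Function.update S k s) 1 := by
    simpa [hS] using Run.pop (k := k) (r := r) (S := S)
  exact (h1.seq h.casesFalse).weaken (by omega)

theorem branch_true {s : List Bool} (hS : S k = true :: s)
    (h : Exec pt (Function.update S k s) S' t) : Exec (.branch k pf pt) S S' (t + 2) := by
  intro r
  obtain ⟨r', h⟩ := h (some true)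
  refine ⟨r', ?_⟩
  have h1 : Run (.pop k) r S (some true) (Function.update S k s) 1 := by
    simpa [hS] using Run.pop (k := k) (r := r) (S := S)
  exact (h1.seq h.casesTrue).weaken (by omega)

end Exec

/-- `Iter k c p S S' t`: the loop `Prog.popLoop k c p` leads from `S` to `S'` in at most `t` steps,
not counting the first `pop`. -/
def Iter (k : Stack) (c : Option Bool → Bool) (p : Prog) (S S' : Stack → List Bool) (t : ℕ) :
    Prop :=
  ∃ r', Run (.loop c (.seq p (.pop k))) (S k).head? (Function.update S k (S k).tail) r' S' t

namespace Iter

variable {p : Prog} {S S₁ S₂ S' : Stack → List Bool} {t t₁ t₂ : ℕ} {k l : Stack}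
  {c : Option Bool → Bool}

theorem exec (h : Iter k c p S S' t) : Exec (.popLoop k c p) S S' (t + 1) := by
  intro r
  obtain ⟨r', h⟩ := h
  exact ⟨r', (Run.pop.seq h).weaken (by omega)⟩

theorem weaken (h : Iter k c p S S' t₁) (hle : t₁ ≤ t₂) : Iter k c p S S' t₂ :=
  h.imp fun _ hr => hr.weaken hle

theorem done (h : c (S k).head? = false) :
    Iter k c p S (Function.update S k (S k).tail) 1 :=
  ⟨_, .loopFalse h⟩

theorem step {r₁ : Option Bool} (hc : c (S k).head? = true)
    (hp : Run p (S k).head? (Function.update S k (S k).tail) r₁ S₁ t₁)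
    (h : Iter k c p S₁ S' t₂) : Iter k c p S S' (t₁ + t₂ + 2) := by
  obtain ⟨r', h⟩ := h
  exact ⟨r', (Run.loopTrue hc (hp.seq .pop) h).weaken (by omega)⟩

theorem step_exec (hc : c (S k).head? = true)
    (hp : Exec p (Function.update S k (S k).tail) S₁ t₁)
    (h : Iter k c p S₁ S' t₂) : Iter k c p S S' (t₁ + t₂ + 2) := by
  obtain ⟨r', hp⟩ := hp (S k).head?
  exact step hc hp h

end Iter

theorem Exec.clear_aux (s a b c : List Bool) :
    Exec (.clear .aux) (stk s a b c) (stk s [] b c) (3 * a.length + 2) := by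
  refine Iter.exec (t := 3 * a.length + 1) ?_
  induction a with
  | nil => simpa using Iter.done (k := .aux) (S := stk s [] b c) (c := Option.isSome) rfl
  | cons x a ih =>
    refine (Iter.step_exec (by simp) (by simpa using Exec.skip) ih).weaken ?_
    simp only [List.length_cons]; omega

theorem Exec.pour {k l : Stack} (hkl : k ≠ l) (S : Stack → List Bool) :
    Exec (.pour k l) S (Function.update (Function.update S k []) l ((S k).reverse ++ S l))
      (4 * (S k).length + 2) := by
  refine Iter.exec (t := 4 * (S k).length + 1) ?_
  generalize hx : S k = x
  induction x generalizing S with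
  | nil =>
    have h := Iter.done (k := k) (S := S) (c := Option.isSome)
      (p := .cases .skip (.push l false) (.push l true)) (by simp [hx])
    have e : Function.update (Function.update S k []) l (S l) = Function.update S k [] := by
      rw [Function.update_eq_self_iff, Function.update_of_ne hkl.symm]
    simpa [hx, e] using h
  | cons x a ih =>
    have h := ih (Function.update (Function.update S k a) l (x :: S l))
      (by simp [Function.update_of_ne hkl])
    have e : Function.update (Function.update (Function.update (Function.update S k a) l
        (x :: S l)) k []) l (a.reverse ++ Function.update (Function.update S k a) l (x :: S l) l) =
        Function.update (Function.update S k []) l ((x :: a).reverse ++ S l) := by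
      funext j
      by_cases hj : j = l <;> by_cases hj' : j = k <;> simp_all
    rw [e] at h
    refine (Iter.step (r₁ := some x) (t₁ := 2) (by simp [hx]) ?_ h).weaken ?_
    · have e' : S l = Function.update S k a l := by simp [Function.update_of_ne hkl.symm]
      rw [hx, List.head?_cons, List.tail_cons, e']
      cases x
      · exact Run.casesFalse Run.push
      · exact Run.casesTrue Run.push
    · simp only [List.length_cons]; omega

theorem Exec.pour_aux_main (s a b c : List Bool) :
    Exec (.pour .aux .main) (stk s a b c) (stk (a.reverse ++ s) [] b c) (4 * a.length + 2) := by
  simpa using Exec.pour (k := .aux) (l := .main) (by decide) (stk s a b c)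

theorem Exec.pour_aux_tmp (s a b c : List Bool) :
    Exec (.pour .aux .tmp) (stk s a b c) (stk s [] (a.reverse ++ b) c) (4 * a.length + 2) := by
  simpa using Exec.pour (k := .aux) (l := .tmp) (by decide) (stk s a b c)

theorem Exec.pour_tmp_aux (s a b c : List Bool) :
    Exec (.pour .tmp .aux) (stk s a b c) (stk s (b.reverse ++ a) [] c) (4 * b.length + 2) := by
  simpa using Exec.pour (k := .tmp) (l := .aux) (by decide) (stk s a b c)

theorem Exec.pour_tmp_count (s a b c : List Bool) :
    Exec (.pour .tmp .count) (stk s a b c) (stk s a [] (b.reverse ++ c)) (4 * b.length + 2) := by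
  simpa using Exec.pour (k := .tmp) (l := .count) (by decide) (stk s a b c)

theorem Exec.pour_count_main (s a b c : List Bool) :
    Exec (.pour .count .main) (stk s a b c) (stk (c.reverse ++ s) a b []) (4 * c.length + 2) := by
  simpa using Exec.pour (k := .count) (l := .main) (by decide) (stk s a b c)

theorem Exec.pourBoth (s a b c : List Bool) :
    Exec .pourBoth (stk s a b c) (stk (a.reverse ++ s) [] (a.reverse ++ b) c)
      (5 * a.length + 2) := by
  refine Iter.exec (t := 5 * a.length + 1) ?_
  induction a generalizing s b with
  | nil => simpa using Iter.done (k := .aux) (S := stk s [] b c) (c := Option.isSome) rfl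
  | cons x a ih =>
    have h := ih (x :: s) (x :: b)
    simp only [List.reverse_cons, List.append_assoc, List.singleton_append]
    refine (Iter.step (r₁ := some x) (t₁ := 3) (by simp) ?_ h).weaken ?_
    · cases x
      · refine Run.casesFalse (Run.seq (t₁ := 1) (t₂ := 1) .push ?_)
        simpa using Run.push (k := .tmp) (b := false) (S := stk (false :: s) a b c)
      · refine Run.casesTrue (Run.seq (t₁ := 1) (t₂ := 1) .push ?_)
        simpa using Run.push (k := .tmp) (b := true) (S := stk (true :: s) a b c)
    · simp only [List.length_cons]; omega

/-! ### Binary trees as data -/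

/-- Binary trees, the data that stack programs work on. -/
inductive Dat
  | nil
  | cons (x y : Dat)

namespace Dat

/-- The prefix code of a tree. -/
def code : Dat → List Bool
  | nil => [false]
  | cons x y => true :: (code x ++ code y)

/-- The length of the code. -/
def size : Dat → ℕ
  | nil => 1
  | cons x y => size x + size y + 1

@[simp] theorem length_code (x : Dat) : x.code.length = x.size := by
  induction x with
  | nil => rfl
  | cons x y hx hy => simp [code, size, hx, hy]

end Dat

namespace Prog

/-- Move the code of a tree from `main` to `aux`; the stack `count` holds one bit for every subtree
that is still to be read. -/
def unload : Prog :=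
  .seq (.push .count true) (popLoop .count Option.isSome
    (branch .main (.push .aux false)
      (.seq (.push .aux true) (.seq (.push .count true) (.push .count true)))))

/-- Remove the topmost tree. -/
def drop : Prog := .seq unload (clear .aux)

/-- Duplicate the topmost tree. -/
def dup : Prog := .seq unload (.seq pourBoth (.seq (pour .tmp .aux) (pour .aux .main)))

/-- Exchange the two topmost trees. -/
def swap : Prog :=
  .seq unload (.seq (pour .aux .tmp) (.seq unload (.seq (pour .tmp .count)
    (.seq (pour .count .main) (pour .aux .main)))))

end Prog

namespace Exec

/-- Reading one complete subtree uses up one bit of the stack `count`: an inner node replaces the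
bit by two, one for each of its subtrees. -/
theorem unload_aux (x : Dat) (s a b c : List Bool) {S' t}
    (h : Iter .count Option.isSome (Prog.branch .main (.push .aux false)
      (.seq (.push .aux true) (.seq (.push .count true) (.push .count true))))
      (stk s (x.code.reverse ++ a) b c) S' t) :
    Iter .count Option.isSome (Prog.branch .main (.push .aux false)
      (.seq (.push .aux true) (.seq (.push .count true) (.push .count true))))
      (stk (x.code ++ s) a b (true :: c)) S' (t + 7 * x.size) := by
  induction x generalizing s a c t with
  | nil =>
    refine (Iter.step_exec (by simp) (t₁ := 3) ?_ h).weaken (by simp [Dat.size]; omega)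
    refine Exec.branch_false (s := s) (by simp [Dat.code]) ?_
    simpa [Dat.code] using Exec.push (k := .aux) (b := false) (S := stk s a b c)
  | cons x y hx hy =>
    have h1 : Iter .count Option.isSome (Prog.branch .main (.push .aux false)
      (.seq (.push .aux true) (.seq (.push .count true) (.push .count true))))
      (stk s (y.code.reverse ++ (x.code.reverse ++ (true :: a))) b c) S' t := by
      simpa [Dat.code] using h
    have h2 := hx _ _ _ (hy _ _ _ h1)
    refine (Iter.step_exec (by simp) (t₁ := 5) ?_ h2).weaken (by simp [Dat.size]; omega)
    refine Exec.branch_true (t := 3) (s := x.code ++ (y.code ++ s)) (by simp [Dat.code]) ?_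
    refine Exec.seq (t₁ := 1) (t₂ := 2) Exec.push (Exec.seq (t₁ := 1) (t₂ := 1) Exec.push ?_)
    simpa [Dat.code] using Exec.push (k := .count) (b := true)
      (S := stk (x.code ++ (y.code ++ s)) (true :: a) b (true :: c))

theorem unload (x : Dat) (s b : List Bool) :
    Exec .unload (stk (x.code ++ s) [] b []) (stk s x.code.reverse b []) (7 * x.size + 3) := by
  refine (Exec.seq (t₁ := 1) (t₂ := 7 * x.size + 2) Exec.push ?_).weaken (by omega)
  refine (Iter.exec (t := 1 + 7 * x.size) ?_).weaken (by omega)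
  rw [update_stk_count]
  refine unload_aux x s [] b [] ?_
  simpa using Iter.done (k := .count) (S := stk s x.code.reverse b []) (c := Option.isSome) rfl

theorem drop (x : Dat) (s : List Bool) :
    Exec .drop (stk (x.code ++ s) [] [] []) (stk s [] [] []) (10 * x.size + 5) :=
  ((unload x s []).seq (clear_aux _ _ _ _)).weaken (by simp; omega)

theorem dup (x : Dat) (s : List Bool) :
    Exec .dup (stk (x.code ++ s) [] [] []) (stk (x.code ++ (x.code ++ s)) [] [] [])
      (20 * x.size + 9) := by
  refine ((unload x s []).seq ((pourBoth _ _ _ _).seq ((pour_tmp_aux _ _ _ _).seq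
    (t₂ := 4 * x.size + 2) ?_))).weaken ?_
  · simpa using pour_aux_main (x.code ++ s) x.code.reverse [] []
  · simp; omega

theorem swap (x y : Dat) (s : List Bool) :
    Exec .swap (stk (x.code ++ (y.code ++ s)) [] [] []) (stk (y.code ++ (x.code ++ s)) [] [] [])
      (19 * x.size + 11 * y.size + 14) := by
  refine ((unload x _ []).seq ((pour_aux_tmp _ _ _ _).seq ((unload y _ _).seq
    ((pour_tmp_count _ _ _ _).seq ((pour_count_main _ _ _ _).seq
    (t₂ := 4 * y.size + 2) ?_))))).weaken ?_
  · simpa using pour_aux_main (x.code ++ s) y.code.reverse [] []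
  · simp; omega

end Exec

end RegularTree

/-! ### Polynomial-time functions on encoded data -/

namespace RegularTree

/-- Types whose elements are represented by binary trees. -/
class Enc (α : Type) where
  enc : α → Dat

export Enc (enc)

/-- The size of the representation of `a`. -/
def size {α : Type} [Enc α] (a : α) : ℕ := (enc a).size

instance : Enc Dat := ⟨id⟩
instance : Enc Unit := ⟨fun _ => .nil⟩
instance : Enc Bool := ⟨fun b => bif b then .cons .nil .nil else .nil⟩
/-- Numbers are represented in unary. -/
instance : Enc ℕ := ⟨fun n => n.rec .nil fun _ d => .cons .nil d⟩
instance {α β : Type} [Enc α] [Enc β] : Enc (α × β) := ⟨fun x => .cons (enc x.1) (enc x.2)⟩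
instance {α : Type} [Enc α] : Enc (List α) :=
  ⟨fun l => l.foldr (fun a d => .cons (enc a) d) .nil⟩

section

variable {α β γ δ ι κ : Type} [Enc α] [Enc β] [Enc γ] [Enc δ] [Enc ι] [Enc κ]

theorem enc_dat (d : Dat) : enc d = d := rfl
theorem enc_false : enc false = .nil := rfl
theorem enc_true : enc true = .cons .nil .nil := rfl
theorem enc_pair (a : α) (b : β) : enc (a, b) = .cons (enc a) (enc b) := rfl
theorem enc_nil : enc ([] : List α) = .nil := rfl
theorem enc_cons (a : α) (l : List α) : enc (a :: l) = .cons (enc a) (enc l) := rfl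

@[simp] theorem size_false : size false = 1 := rfl
@[simp] theorem size_true : size true = 3 := rfl
@[simp] theorem size_nat (n : ℕ) : size n = 2 * n + 1 := by
  induction n with
  | zero => rfl
  | succ n ih =>
    have : size (n + 1) = 1 + size n + 1 := rfl
    omega
@[simp] theorem size_pair (a : α) (b : β) : size (a, b) = size a + size b + 1 := rfl
@[simp] theorem size_nil : size ([] : List α) = 1 := rfl
@[simp] theorem size_cons (a : α) (l : List α) : size (a :: l) = size a + size l + 1 := rfl

theorem one_le_size (a : α) : 1 ≤ size a := by
  unfold size
  cases enc a <;> simp [Dat.size]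

theorem size_bool_le (b : Bool) : size b ≤ 3 := by cases b <;> simp

theorem length_le_size (l : List α) : l.length ≤ size l := by
  induction l with
  | nil => simp
  | cons a l ih => simp; omega

theorem size_le_of_mem {l : List α} {a : α} (h : a ∈ l) : size a ≤ size l := by
  induction l with
  | nil => simp at h
  | cons b l ih =>
    rcases List.mem_cons.1 h with rfl | h
    · simp; omega
    · have := ih h
      simp; omega

theorem size_list_le {l : List α} {m : ℕ} (h : ∀ a ∈ l, size a ≤ m) :
    size l ≤ l.length * (m + 1) + 1 := by
  induction l with
  | nil => simp
  | cons a l ih =>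
    have h1 := ih fun b hb => h b (List.mem_cons_of_mem _ hb)
    have h2 := h a List.mem_cons_self
    simp only [size_cons, List.length_cons]
    linarith

theorem size_append (l l' : List α) : size (l ++ l') + 1 = size l + size l' := by
  induction l with
  | nil => simp; omega
  | cons a l ih => simp only [List.cons_append, size_cons]; omega

theorem size_reverse (l : List α) : size l.reverse = size l := by
  induction l with
  | nil => rfl
  | cons a l ih =>
    have := size_append l.reverse [a]
    simp only [List.reverse_cons, size_cons, size_nil] at this ⊢
    omega

theorem size_le_of_prefix {l l' : List α} (h : l' <+: l) : size l' ≤ size l := by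
  obtain ⟨t, rfl⟩ := h
  have := size_append l' t
  have := one_le_size t
  omega

theorem size_tail_le (l : List α) : size l.tail ≤ size l := by
  cases l <;> simp; omega

/-! ### Polynomial bounds -/

theorem eval_mono (p : Polynomial ℕ) {m n : ℕ} (h : m ≤ n) : p.eval m ≤ p.eval n := by
  rw [Polynomial.eval_eq_sum, Polynomial.eval_eq_sum]
  exact Finset.sum_le_sum fun i _ => Nat.mul_le_mul_left _ (Nat.pow_le_pow_left h i)

/-- `t a` is bounded by a polynomial in the size of `a`. -/
def PolyBdd (t : α → ℕ) : Prop := ∃ p : Polynomial ℕ, ∀ a, t a ≤ p.eval (size a)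

namespace PolyBdd

variable {s t : α → ℕ}

theorem const (n : ℕ) : PolyBdd fun _ : α => n := ⟨Polynomial.C n, fun a => by simp⟩

theorem size : PolyBdd fun a : α => size a := ⟨Polynomial.X, fun a => by simp⟩

theorem add (hs : PolyBdd s) (ht : PolyBdd t) : PolyBdd fun a => s a + t a := by
  obtain ⟨p, hp⟩ := hs
  obtain ⟨q, hq⟩ := ht
  exact ⟨p + q, fun a => by simpa using add_le_add (hp a) (hq a)⟩

theorem mul (hs : PolyBdd s) (ht : PolyBdd t) : PolyBdd fun a => s a * t a := by
  obtain ⟨p, hp⟩ := hs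
  obtain ⟨q, hq⟩ := ht
  exact ⟨p * q, fun a => by simpa using Nat.mul_le_mul (hp a) (hq a)⟩

theorem of_le (ht : PolyBdd t) (h : ∀ a, s a ≤ t a) : PolyBdd s :=
  ht.imp fun _ hp a => (h a).trans (hp a)

theorem eval (hs : PolyBdd s) (p : Polynomial ℕ) : PolyBdd fun a => p.eval (s a) := by
  obtain ⟨q, hq⟩ := hs
  exact ⟨p.comp q, fun a => by simpa using eval_mono p (hq a)⟩

theorem comp {t : β → ℕ} {f : α → β} (ht : PolyBdd t)
    (hf : PolyBdd fun a => RegularTree.size (f a)) : PolyBdd fun a => t (f a) := by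
  obtain ⟨p, hp⟩ := ht
  exact (hf.eval p).of_le fun a => hp (f a)

end PolyBdd

/-! ### The class of polynomial-time functions -/

/-- `f` is computed by a stack program in polynomial time: the code of an argument on top of the
stack `main` is replaced by the code of the value, and the other stacks are empty before and
afterwards. -/
def PolyTime (f : α → β) : Prop :=
  ∃ (p : Prog) (t : α → ℕ), PolyBdd t ∧ PolyBdd (fun a => size (f a)) ∧
    ∀ a s, Exec p (stk ((enc a).code ++ s) [] [] []) (stk ((enc (f a)).code ++ s) [] [] []) (t a)

theorem PolyTime.size {f : α → β} (hf : PolyTime f) : PolyBdd fun a => size (f a) := by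
  obtain ⟨_, _, _, h, _⟩ := hf
  exact h

namespace PolyTime

/-- Being computable in polynomial time depends only on the representations. -/
theorem recode {f : α → β} {f' : γ → δ} (hf : PolyTime f) (φ : γ → α)
    (hφ : ∀ c, enc (φ c) = enc c) (h : ∀ c, enc (f' c) = enc (f (φ c))) : PolyTime f' := by
  obtain ⟨p, t, ht, hs, hp⟩ := hf
  have hb : PolyBdd fun c => RegularTree.size (φ c) :=
    PolyBdd.size.of_le fun c => by simp only [RegularTree.size, hφ]; rfl
  refine ⟨p, fun c => t (φ c), ht.comp hb, (hs.comp hb).of_le fun c => ?_, fun c s => ?_⟩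
  · simp only [RegularTree.size, h]; rfl
  · rw [h, ← hφ]
    exact hp _ _

theorem id : PolyTime fun a : α => a :=
  ⟨.skip, fun _ => 1, PolyBdd.const 1, PolyBdd.size, fun _ _ => Exec.skip⟩

theorem comp {f : β → γ} {g : α → β} (hf : PolyTime f) (hg : PolyTime g) :
    PolyTime fun a => f (g a) := by
  obtain ⟨p, t, ht, hs, hp⟩ := hf
  obtain ⟨q, u, hu, hs', hq⟩ := hg
  exact ⟨.seq q p, fun a => u a + t (g a), hu.add (ht.comp hs'), hs.comp hs',
    fun a s => (hq a s).seq (hp _ s)⟩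

theorem constNil : PolyTime fun _ : α => Dat.nil := by
  refine ⟨.seq .drop (.push .main false), fun a => 10 * RegularTree.size a + 6,
    ((PolyBdd.const 10).mul .size).add (.const 6), PolyBdd.const 1, fun a s => ?_⟩
  exact ((Exec.drop (enc a) s).seq Exec.push).of_eq rfl (by simp [enc_dat, Dat.code])
    (by simp only [RegularTree.size]; omega)

theorem pair {f : α → β} {g : α → γ} (hf : PolyTime f) (hg : PolyTime g) :
    PolyTime fun a => (f a, g a) := by
  obtain ⟨p, t, ht, hs, hp⟩ := hf
  obtain ⟨q, u, hu, hs', hq⟩ := hg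
  refine ⟨.seq .dup (.seq q (.seq .swap (.seq p (.push .main true)))), fun a =>
    (20 * RegularTree.size a + 9) + (u a + ((19 * RegularTree.size (g a) +
      11 * RegularTree.size a + 14) + (t a + 1))), ?_, (hs.add hs').add (.const 1), fun a s => ?_⟩
  · exact (((PolyBdd.const _).mul .size).add (.const _)).add (hu.add (((((PolyBdd.const _).mul
      hs').add ((PolyBdd.const _).mul .size)).add (.const _)).add (ht.add (.const _))))
  · refine (Exec.dup _ _).seq ((hq a _).seq ((Exec.swap _ _ _).seq ((hp a _).seq ?_)))
    simpa [enc_pair, Dat.code] using Exec.push (k := .main) (b := true)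
      (S := stk ((enc (f a)).code ++ ((enc (g a)).code ++ s)) [] [] [])

theorem fst : PolyTime fun x : α × β => x.1 := by
  refine ⟨.branch .main .skip (.seq .swap .drop), fun x => 40 * RegularTree.size x + 21,
    ((PolyBdd.const _).mul .size).add (.const _), PolyBdd.size.of_le fun x => ?_, fun x s => ?_⟩
  · obtain ⟨a, b⟩ := x
    simp; omega
  · obtain ⟨a, b⟩ := x
    have h := (Exec.swap (enc a) (enc b) s).seq (Exec.drop _ _)
    rw [← update_stk_main ((enc (a, b)).code ++ s)] at h
    refine (Exec.branch_true (by simp [enc_pair, Dat.code]) h).weaken ?_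
    simp only [RegularTree.size, enc_pair, Dat.size]; omega

theorem snd : PolyTime fun x : α × β => x.2 := by
  refine ⟨.branch .main .skip .drop, fun x => 10 * RegularTree.size x + 7,
    ((PolyBdd.const _).mul .size).add (.const _), PolyBdd.size.of_le fun x => ?_, fun x s => ?_⟩
  · obtain ⟨a, b⟩ := x
    simp; omega
  · obtain ⟨a, b⟩ := x
    have h := Exec.drop (enc a) ((enc b).code ++ s)
    rw [← update_stk_main ((enc (a, b)).code ++ s)] at h
    refine (Exec.branch_true (by simp [enc_pair, Dat.code]) h).weaken ?_
    simp only [RegularTree.size, enc_pair, Dat.size]; omega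

/-- Case distinction on the form of the tree that represents `d a`. In the second case the
components are handed on in the form of some `c : κ`. -/
theorem cases {d : α → β} {f h : α → γ} {g : κ → γ} (hd : PolyTime d) (hf : PolyTime f)
    (hg : PolyTime g)
    (H : ∀ a, (enc (d a) = .nil ∧ h a = f a) ∨
      ∃ x y c, enc (d a) = .cons x y ∧ enc c = .cons (enc a) (.cons x y) ∧ h a = g c) :
    PolyTime h := by
  obtain ⟨r, v, hv, hs'', hr⟩ := hd
  obtain ⟨p, ⟨t, ⟨tp, htp⟩, ⟨sp, hsp⟩, hp⟩⟩ := hf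
  obtain ⟨q, ⟨u, ⟨up, hup⟩, ⟨sq, hsq⟩, hq⟩⟩ := hg
  have hb : PolyBdd fun a => RegularTree.size a + RegularTree.size (d a) + 1 :=
    (PolyBdd.size.add hs'').add (.const _)
  refine ⟨.seq .dup (.seq r (.branch .main p (.seq (.push .main true) (.seq .swap
    (.seq (.push .main true) q))))), fun a => (20 * RegularTree.size a + 9) + (v a +
    ((tp.eval (RegularTree.size a) + ((19 * RegularTree.size (d a) + 11 * RegularTree.size a +
      14) + up.eval (RegularTree.size a + RegularTree.size (d a) + 1))) + 4)), ?_,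
    (((PolyBdd.size (α := α)).eval sp).add (hb.eval sq)).of_le fun a => ?_, fun a s => ?_⟩
  · exact (((PolyBdd.const _).mul .size).add (.const _)).add (hv.add ((((PolyBdd.size.eval tp).add
      (((((PolyBdd.const _).mul hs'').add ((PolyBdd.const _).mul .size)).add (.const _)).add
      (hb.eval up)))).add (.const _)))
  · rcases H a with ⟨-, h1⟩ | ⟨x, y, c, h1, h2, h3⟩
    · rw [h1]
      exact (hsp a).trans (by omega)
    · have : RegularTree.size c = RegularTree.size a + RegularTree.size (d a) + 1 := by
        simp only [RegularTree.size, h1, h2, Dat.size]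
      rw [h3, ← this]
      exact (hsq c).trans (by omega)
  · refine (Exec.dup _ _).seq ((hr a _).seq ?_)
    rcases H a with ⟨h0, h1⟩ | ⟨x, y, c, h1, h2, h3⟩
    · refine (Exec.branch_false (s := (enc a).code ++ s) (by simp [h0, Dat.code]) ?_).weaken
        (t₁ := tp.eval (RegularTree.size a) + 2) (by omega)
      rw [update_stk_main, h1]
      exact (hp a s).weaken (htp a)
    · have hc : RegularTree.size c = RegularTree.size a + RegularTree.size (d a) + 1 := by
        simp only [RegularTree.size, h1, h2, Dat.size]
      have e1 : Exec (.push .main true) (stk (x.code ++ (y.code ++ ((enc a).code ++ s))) [] [] [])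
          (stk ((enc (d a)).code ++ ((enc a).code ++ s)) [] [] []) 1 :=
        Exec.push.of_eq rfl (by simp [h1, Dat.code]) le_rfl
      have e2 : Exec (.push .main true) (stk ((enc a).code ++ ((enc (d a)).code ++ s)) [] [] [])
          (stk ((enc c).code ++ s) [] [] []) 1 :=
        Exec.push.of_eq rfl (by simp [h1, h2, Dat.code]) le_rfl
      have e3 := e1.seq ((Exec.swap _ _ _).seq (e2.seq ((hq c s).weaken (hup c))))
      rw [← update_stk_main ((enc (d a)).code ++ ((enc a).code ++ s)), ← h3] at e3
      refine (Exec.branch_true (by simp [h1, Dat.code]) e3).weaken ?_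
      rw [hc]
      simp only [RegularTree.size]
      omega

end PolyTime

end

end RegularTree

/-! ### Iteration over a list -/

namespace RegularTree

section

variable {α β γ δ ι κ : Type} [Enc α] [Enc β] [Enc γ] [Enc δ] [Enc ι] [Enc κ]

/-- The body of the loop that folds a step function, computed by `pg`, over a list. It is entered
after the first bit of the code of the list has been removed, so the stack holds the head, the tail
and the accumulator; `pr` rearranges them. -/
def Prog.foldBody (pr pg : Prog) : Prog :=
  .seq (.push .main true) (.seq (.push .main true) (.seq pr (.branch .main .skip (.seq pg .swap))))

/-- The loop that folds `g` over the list on top of the stack, with the accumulator below it. The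
bound `m` applies to the list and to all intermediate values of the accumulator. -/
theorem Iter.fold {g : β × γ → γ} {pr pg : Prog} {tr tg : Polynomial ℕ}
    (hr : ∀ (x : (β × List β) × γ) s, Exec pr (stk ((enc x).code ++ s) [] [] [])
      (stk ((enc ((x.1.1, x.2), x.1.2)).code ++ s) [] [] []) (tr.eval (size x)))
    (hg : ∀ x s, Exec pg (stk ((enc x).code ++ s) [] [] []) (stk ((enc (g x)).code ++ s) [] [] [])
      (tg.eval (size x)))
    (m : ℕ) (s : List Bool) (l : List β) (c : γ) (hl : size l ≤ m)
    (hm : ∀ l', l' <+: l → size (l'.foldl (fun c b => g (b, c)) c) ≤ m) :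
    Iter .main (· == some true) (.foldBody pr pg)
      (stk ((enc l).code ++ ((enc c).code ++ s)) [] [] [])
      (stk ((enc (l.foldl (fun c b => g (b, c)) c)).code ++ s) [] [] [])
      (1 + l.length * (30 * m + 20 + tr.eval (2 * m + 1) + tg.eval (2 * m + 1))) := by
  induction l generalizing c with
  | nil =>
    have h := Iter.done (k := .main) (c := (· == some true)) (p := .foldBody pr pg)
      (S := stk ((enc ([] : List β)).code ++ ((enc c).code ++ s)) [] [] []) rfl
    simpa [enc_nil, Dat.code] using h
  | cons b l ih =>
    have hc : size c ≤ m := hm [] (List.nil_prefix)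
    have hc' : size (g (b, c)) ≤ m := hm [b] (by simp)
    simp only [size_cons] at hl
    have h := ih (g (b, c)) (by omega) fun l' hl' => hm (b :: l') (by simpa using hl')
    have e1 : Exec (.push .main true)
        (stk ((enc b).code ++ ((enc l).code ++ ((enc c).code ++ s))) [] [] [])
        (stk ((enc (b, l)).code ++ ((enc c).code ++ s)) [] [] []) 1 :=
      Exec.push.of_eq rfl (by simp [enc_pair, Dat.code]) le_rfl
    have e2 : Exec (.push .main true) (stk ((enc (b, l)).code ++ ((enc c).code ++ s)) [] [] [])
        (stk ((enc ((b, l), c)).code ++ s) [] [] []) 1 :=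
      Exec.push.of_eq rfl (by simp [enc_pair, Dat.code]) le_rfl
    have e3 := (hg (b, c) ((enc l).code ++ s)).seq (Exec.swap _ _ s)
    rw [← update_stk_main ((enc ((b, c), l)).code ++ s)] at e3
    have e4 : Exec (.branch .main .skip (.seq pg .swap)) _ _ _ :=
      Exec.branch_true (by simp [enc_pair, Dat.code]) e3
    have e5 := e1.seq (e2.seq ((hr ((b, l), c) s).seq e4))
    have e6 : Function.update (stk ((enc (b :: l)).code ++ ((enc c).code ++ s)) [] [] []) .main
        (stk ((enc (b :: l)).code ++ ((enc c).code ++ s)) [] [] [] .main).tail =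
        stk ((enc b).code ++ ((enc l).code ++ ((enc c).code ++ s))) [] [] [] := by
      simp [enc_cons, Dat.code]
    rw [← e6] at e5
    refine (Iter.step_exec ?_ e5 h).weaken ?_
    · simp [enc_cons, Dat.code]
    · have h1 : tr.eval (size ((b, l), c)) ≤ tr.eval (2 * m + 1) :=
        eval_mono _ (by simp only [size_pair]; omega)
      have h2 : tg.eval (size (b, c)) ≤ tg.eval (2 * m + 1) :=
        eval_mono _ (by simp only [size_pair]; omega)
      have h3 : (enc (g (b, c))).size ≤ m := hc'
      have h4 : (enc l).size + 1 ≤ m := by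
        change size l + 1 ≤ m
        have := one_le_size b
        omega
      rw [List.length_cons, add_mul]
      simp only [one_mul]
      omega

namespace PolyTime

/-- Folding a function of an element and the accumulator over a list. -/
theorem foldl_core {l : α → List β} {s : α → γ} {g : β × γ → γ} (hl : PolyTime l)
    (hs : PolyTime s) (hg : PolyTime g)
    (hb : ∃ t : α → ℕ, PolyBdd t ∧ ∀ a l', l' <+: l a →
      RegularTree.size (l'.foldl (fun c b => g (b, c)) (s a)) ≤ t a) :
    PolyTime fun a => (l a).foldl (fun c b => g (b, c)) (s a) := by
  have hr : PolyTime fun x : (β × List β) × γ => ((x.1.1, x.2), x.1.2) :=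
    ((fst.comp fst).pair snd).pair (snd.comp fst)
  obtain ⟨pr, ur, ⟨tr, htr⟩, -, hr⟩ := hr
  obtain ⟨pg, ug, ⟨tg, htg⟩, -, hg⟩ := hg
  obtain ⟨b, hb, hb'⟩ := hb
  obtain ⟨q, v, hv, -, hq⟩ := hl.pair hs
  have hm : PolyBdd fun a => RegularTree.size (l a) + b a := hl.size.add hb
  refine ⟨.seq q (.branch .main .skip (.popLoop .main (· == some true) (.foldBody pr pg))),
    fun a => v a + ((1 + RegularTree.size (l a) * (30 * (RegularTree.size (l a) + b a) + 20 +
      tr.eval (2 * (RegularTree.size (l a) + b a) + 1) +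
      tg.eval (2 * (RegularTree.size (l a) + b a) + 1))) + 3), ?_,
    hb.of_le fun a => hb' a _ (List.prefix_refl _), fun a t => (hq a t).seq ?_⟩
  · exact hv.add (((PolyBdd.const 1).add (hl.size.mul (((((PolyBdd.const _).mul hm).add
      (.const _)).add ((((PolyBdd.const _).mul hm).add (.const _)).eval _)).add
      ((((PolyBdd.const _).mul hm).add (.const _)).eval _)))).add (.const _))
  · have h := (Iter.fold (fun x s => (hr x s).weaken (htr x)) (fun x s => (hg x s).weaken (htg x))
      (RegularTree.size (l a) + b a) t (l a) (s a) (by omega)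
      fun l' hl' => (hb' a l' hl').trans (by omega)).exec
    rw [← update_stk_main ((enc (l a, s a)).code ++ t)] at h
    refine (Exec.branch_true (by simp [enc_pair, Dat.code]) h).weaken ?_
    have := Nat.mul_le_mul_right (30 * (RegularTree.size (l a) + b a) + 20 +
      tr.eval (2 * (RegularTree.size (l a) + b a) + 1) +
      tg.eval (2 * (RegularTree.size (l a) + b a) + 1)) (length_le_size (l a))
    omega

end PolyTime

end

end RegularTree

/-! ### A library of polynomial-time functions -/

namespace RegularTree

attribute [fun_prop] PolyTime

section

variable {α β γ δ ι κ : Type} [Enc α] [Enc β] [Enc γ] [Enc δ] [Enc ι] [Enc κ]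

namespace PolyTime

attribute [fun_prop] id comp fst snd

@[fun_prop]
theorem prodMk {f : α → β} {g : α → γ} (hf : PolyTime f) (hg : PolyTime g) :
    PolyTime fun a => (f a, g a) := hf.pair hg

@[fun_prop]
theorem proj_fst {f : α → β × γ} (hf : PolyTime f) : PolyTime fun a => (f a).1 := fst.comp hf

@[fun_prop]
theorem proj_snd {f : α → β × γ} (hf : PolyTime f) : PolyTime fun a => (f a).2 := snd.comp hf

@[fun_prop]
theorem const (b : β) : PolyTime fun _ : α => b := by
  have h : ∀ d : Dat, PolyTime fun _ : α => d := by
    intro d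
    induction d with
    | nil => exact constNil
    | cons x y hx hy => exact (hx.pair hy).recode _root_.id (fun _ => rfl) fun _ => rfl
  exact (h (enc b)).recode _root_.id (fun _ => rfl) fun _ => rfl

@[fun_prop]
theorem bcond {c : α → Bool} {f g : α → β} (hc : PolyTime c) (hf : PolyTime f)
    (hg : PolyTime g) : PolyTime fun a => bif c a then f a else g a := by
  refine cases (g := fun x : α × Dat × Dat => f x.1) hc hg (hf.comp fst) fun a => ?_
  cases h : c a
  · exact .inl ⟨rfl, rfl⟩
  · exact .inr ⟨.nil, .nil, (a, .nil, .nil), rfl, rfl, rfl⟩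

@[fun_prop]
theorem band {f g : α → Bool} (hf : PolyTime f) (hg : PolyTime g) :
    PolyTime fun a => f a && g a :=
  (hf.bcond hg (const false)).recode _root_.id (fun _ => rfl) fun a => by
    simp only [_root_.id]; cases f a <;> rfl

@[fun_prop]
theorem bor {f g : α → Bool} (hf : PolyTime f) (hg : PolyTime g) :
    PolyTime fun a => f a || g a :=
  (hf.bcond (const true) hg).recode _root_.id (fun _ => rfl) fun a => by
    simp only [_root_.id]; cases f a <;> rfl

@[fun_prop]
theorem bnot {f : α → Bool} (hf : PolyTime f) : PolyTime fun a => !f a :=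
  (hf.bcond (const false) (const true)).recode _root_.id (fun _ => rfl) fun a => by
    simp only [_root_.id]; cases f a <;> rfl

@[fun_prop]
theorem bool_beq {f g : α → Bool} (hf : PolyTime f) (hg : PolyTime g) :
    PolyTime fun a => f a == g a :=
  (hf.bcond hg hg.bnot).recode _root_.id (fun _ => rfl) fun a => by
    simp only [_root_.id]; cases f a <;> cases g a <;> rfl

@[fun_prop]
theorem bxor {f g : α → Bool} (hf : PolyTime f) (hg : PolyTime g) :
    PolyTime fun a => xor (f a) (g a) :=
  (hf.bcond hg.bnot hg).recode _root_.id (fun _ => rfl) fun a => by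
    simp only [_root_.id]; cases f a <;> cases g a <;> rfl

/-! #### Constructors and destructors of numbers and lists -/

@[fun_prop]
theorem cons {f : α → β} {l : α → List β} (hf : PolyTime f) (hl : PolyTime l) :
    PolyTime fun a => f a :: l a :=
  (hf.pair hl).recode _root_.id (fun _ => rfl) fun _ => rfl

@[fun_prop]
theorem tail {l : α → List β} (hl : PolyTime l) : PolyTime fun a => (l a).tail := by
  refine cases (g := fun x : α × β × List β => x.2.2) hl (const []) (by fun_prop) fun a => ?_
  cases h : l a with
  | nil => exact .inl ⟨rfl, rfl⟩
  | cons b t => exact .inr ⟨_, _, (a, b, t), rfl, rfl, rfl⟩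

@[fun_prop]
theorem headD {l : α → List β} {d : α → β} (hl : PolyTime l) (hd : PolyTime d) :
    PolyTime fun a => (l a).headD (d a) := by
  refine cases (g := fun x : α × β × List β => x.2.1) hl hd (by fun_prop) fun a => ?_
  cases h : l a with
  | nil => exact .inl ⟨rfl, rfl⟩
  | cons b t => exact .inr ⟨_, _, (a, b, t), rfl, rfl, rfl⟩

@[fun_prop]
theorem isEmpty {l : α → List β} (hl : PolyTime l) : PolyTime fun a => (l a).isEmpty := by
  refine cases (g := fun x : α × β × List β => false) hl (const true) (by fun_prop) fun a => ?_
  cases h : l a with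
  | nil => exact .inl ⟨rfl, rfl⟩
  | cons b t => exact .inr ⟨_, _, (a, b, t), rfl, rfl, rfl⟩

theorem succ {n : α → ℕ} (hn : PolyTime n) : PolyTime fun a => n a + 1 :=
  ((const Dat.nil).pair hn).recode _root_.id (fun _ => rfl) fun _ => rfl

theorem pred {n : α → ℕ} (hn : PolyTime n) : PolyTime fun a => (n a).pred := by
  refine cases (g := fun x : α × Dat × ℕ => x.2.2) hn (const 0) (by fun_prop) fun a => ?_
  cases h : n a with
  | zero => exact .inl ⟨rfl, rfl⟩
  | succ n => exact .inr ⟨_, _, (a, .nil, n), rfl, rfl, rfl⟩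

theorem eqZero {n : α → ℕ} (hn : PolyTime n) : PolyTime fun a => n a == 0 := by
  refine cases (g := fun x : α × Dat × ℕ => false) hn (const true) (by fun_prop) fun a => ?_
  cases h : n a with
  | zero => exact .inl ⟨rfl, rfl⟩
  | succ n => exact .inr ⟨_, _, (a, .nil, n), rfl, rfl, rfl⟩

/-! #### Folds and iterations -/

/-- Folding a polynomial-time function over a list takes polynomial time if all intermediate
results are of polynomial size. -/
theorem foldl {l : α → List β} {s : α → γ} {g : α → γ → β → γ} (hl : PolyTime l)
    (hs : PolyTime s) (hg : PolyTime fun x : α × γ × β => g x.1 x.2.1 x.2.2) {t : α → ℕ}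
    (ht : PolyBdd t) (hb : ∀ a l', l' <+: l a → RegularTree.size (l'.foldl (g a) (s a)) ≤ t a) :
    PolyTime fun a => (l a).foldl (g a) (s a) := by
  have key : ∀ (a : α) (l : List β) (c : γ),
      l.foldl (fun (p : α × γ) b => (p.1, g p.1 p.2 b)) (a, c) = (a, l.foldl (g a) c) := by
    intro a l
    induction l with
    | nil => intro c; rfl
    | cons b l ih => intro c; exact ih _
  have h := foldl_core (l := l) (s := fun a => (a, s a)) (g := fun x : β × (α × γ) =>
    (x.2.1, g x.2.1 x.2.2 x.1)) hl (by fun_prop)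
    ((proj_fst snd).pair (hg.comp (g := fun x : β × (α × γ) => (x.2.1, x.2.2, x.1)) (by fun_prop)))
    ⟨fun a => RegularTree.size a + t a + 1, (PolyBdd.size.add ht).add (.const _), fun a l' hl' => by
      rw [key, size_pair]
      exact Nat.succ_le_succ (Nat.add_le_add_left (hb a l' hl') _)⟩
  refine (snd.comp h).recode _root_.id (fun _ => rfl) fun a => ?_
  simp only [key, _root_.id]

@[fun_prop]
theorem replicate_unit {n : α → ℕ} (hn : PolyTime n) :
    PolyTime fun a => List.replicate (n a) () := by
  refine hn.recode _root_.id (fun _ => rfl) fun a => ?_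
  simp only [_root_.id]
  induction n a with
  | zero => rfl
  | succ n ih => simp [List.replicate_succ, enc_cons, ih]; rfl

/-- Iterating a polynomial-time function takes polynomial time if all intermediate results are of
polynomial size. -/
theorem iterate {n : α → ℕ} {s : α → γ} {g : α → γ → γ} (hn : PolyTime n) (hs : PolyTime s)
    (hg : PolyTime fun x : α × γ => g x.1 x.2) {t : α → ℕ} (ht : PolyBdd t)
    (hb : ∀ a, ∀ i ≤ n a, RegularTree.size ((g a)^[i] (s a)) ≤ t a) :
    PolyTime fun a => (g a)^[n a] (s a) := by
  have key : ∀ (a : α) (i : ℕ) (c : γ),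
      (List.replicate i ()).foldl (fun c _ => g a c) c = (g a)^[i] c := by
    intro a i
    induction i with
    | zero => intro c; rfl
    | succ i ih => intro c; simp [List.replicate_succ, ih]
  have h := foldl (l := fun a => List.replicate (n a) ()) (s := s) (g := fun a c _ => g a c)
    (by fun_prop) hs
    (hg.comp (g := fun x : α × γ × Unit => (x.1, x.2.1)) (by fun_prop)) ht fun a l' hl' => by
      obtain ⟨hle, e⟩ := List.prefix_replicate_iff.1 hl'
      rw [e, key]
      exact hb a _ hle
  simpa only [key] using h

/-- Iteration of a function all of whose values are of polynomial size. -/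
theorem iterate_of_bdd {n : α → ℕ} {s : α → γ} {g : α → γ → γ} (hn : PolyTime n) (hs : PolyTime s)
    (hg : PolyTime fun x : α × γ => g x.1 x.2) {t : α → ℕ} (ht : PolyBdd t)
    (hb : ∀ a c, RegularTree.size (g a c) ≤ t a) :
    PolyTime fun a => (g a)^[n a] (s a) := by
  refine iterate hn hs hg (hs.size.add ht) fun a i _ => ?_
  cases i with
  | zero => exact Nat.le_add_right _ _
  | succ i =>
    rw [Function.iterate_succ_apply']
    exact (hb _ _).trans (Nat.le_add_left _ _)

/-! #### Arithmetic -/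

theorem _root_.RegularTree.polyBdd_of_polyTime {n : α → ℕ} (hn : PolyTime n) : PolyBdd n :=
  hn.size.of_le fun a => by rw [size_nat]; omega

@[fun_prop]
theorem add {m n : α → ℕ} (hm : PolyTime m) (hn : PolyTime n) : PolyTime fun a => m a + n a := by
  have e : ∀ m i : ℕ, (· + 1)^[i] m = m + i := fun m i => by simp
  have h := iterate (g := fun _ c => c + 1) hn hm snd.succ
    (((PolyBdd.const 2).mul ((polyBdd_of_polyTime hm).add (polyBdd_of_polyTime hn))).add (.const 1))
    fun a i hi => by rw [e, size_nat]; omega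
  simpa only [e] using h

@[fun_prop]
theorem sub {m n : α → ℕ} (hm : PolyTime m) (hn : PolyTime n) : PolyTime fun a => m a - n a := by
  have e : ∀ m i : ℕ, Nat.pred^[i] m = m - i := fun m i => Nat.pred_iterate m i
  have h := iterate (g := fun _ c => c.pred) hn hm snd.pred
    (((PolyBdd.const 2).mul (polyBdd_of_polyTime hm)).add (.const 1))
    fun a i hi => by
      have : (fun c => Nat.pred c)^[i] (m a) = m a - i := e _ _
      rw [this, size_nat]; omega
  have e' : ∀ m i : ℕ, (fun c => Nat.pred c)^[i] m = m - i := e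
  simpa only [e'] using h

@[fun_prop]
theorem mul {m n : α → ℕ} (hm : PolyTime m) (hn : PolyTime n) : PolyTime fun a => m a * n a := by
  have e : ∀ m i : ℕ, (fun c => c + m)^[i] 0 = m * i := fun m i => by simp [mul_comm]
  have h := iterate (g := fun a c => c + m a) hn (const 0) (snd.add (hm.comp fst))
    (((PolyBdd.const 2).mul ((polyBdd_of_polyTime hm).mul (polyBdd_of_polyTime hn))).add (.const 1))
    fun a i hi => by
      have := Nat.mul_le_mul_left (m a) hi
      rw [e, size_nat]; omega
  simpa only [e] using h

@[fun_prop]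
theorem decideLt {m n : α → ℕ} (hm : PolyTime m) (hn : PolyTime n) :
    PolyTime fun a => decide (m a < n a) := by
  have h := (eqZero (hn.sub hm)).bnot
  refine h.recode _root_.id (fun _ => rfl) fun a => congrArg _ ?_
  rw [Bool.eq_iff_iff]
  simp
  omega

@[fun_prop]
theorem nat_beq {m n : α → ℕ} (hm : PolyTime m) (hn : PolyTime n) :
    PolyTime fun a => m a == n a := by
  have h := ((hm.decideLt hn).bor (hn.decideLt hm)).bnot
  refine h.recode _root_.id (fun _ => rfl) fun a => congrArg _ ?_
  rw [Bool.eq_iff_iff]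
  simp
  omega

/-! #### Lists -/

@[fun_prop]
theorem reverse {l : α → List β} (hl : PolyTime l) : PolyTime fun a => (l a).reverse := by
  have e : ∀ l : List β, l.foldl (fun c b => b :: c) [] = l.reverse := fun l => by simp
  have h := foldl (g := fun _ c b => b :: c) hl (const []) (by fun_prop) hl.size fun a l' hl' => by
    rw [e, size_reverse]
    exact size_le_of_prefix hl'
  simpa only [e] using h

@[fun_prop]
theorem append {l l' : α → List β} (hl : PolyTime l) (hl' : PolyTime l') :
    PolyTime fun a => l a ++ l' a := by
  have e : ∀ l l' : List β, l.foldl (fun c b => b :: c) l' = l.reverse ++ l' := fun l l' => by simp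
  have h := foldl (g := fun _ c b => b :: c) hl.reverse hl' (by fun_prop) (hl.size.add hl'.size)
    fun a l₁ h₁ => by
      have h2 := size_append l₁.reverse (l' a)
      have h3 := size_le_of_prefix h₁
      rw [size_reverse] at h2 h3
      rw [e]
      omega
  simpa only [e, List.reverse_reverse] using h

@[fun_prop]
theorem length {l : α → List β} (hl : PolyTime l) : PolyTime fun a => (l a).length := by
  have e : ∀ l : List β, l.foldl (fun c _ => c + 1) 0 = l.length := fun l => by
    induction l using List.reverseRecOn <;> simp_all
  have h := foldl (g := fun _ c _ => c + 1) hl (const 0) (by fun_prop)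
    (((PolyBdd.const 2).mul hl.size).add (.const 1)) fun a l' hl' => by
      have := hl'.length_le
      have := length_le_size (l a)
      rw [e, size_nat]
      omega
  simpa only [e] using h

@[fun_prop]
theorem map {l : α → List β} {g : α → β → γ} (hl : PolyTime l)
    (hg : PolyTime fun x : α × β => g x.1 x.2) : PolyTime fun a => (l a).map (g a) := by
  have e : ∀ (g : β → γ) (l : List β), l.foldl (fun c b => g b :: c) [] = (l.map g).reverse := by
    intro g l
    induction l using List.reverseRecOn <;> simp_all
  obtain ⟨p, hp⟩ := hg.size
  have h := foldl (g := fun a c b => g a b :: c) hl (const [])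
    ((hg.comp (g := fun x : α × List γ × β => (x.1, x.2.2)) (by fun_prop)).cons (by fun_prop))
    ((hl.size.mul ((((PolyBdd.size.add hl.size).add (.const 1)).eval p).add (.const 1))).add
      (.const 1)) fun a l' hl' => by
      rw [e, size_reverse]
      refine (size_list_le (m := p.eval (RegularTree.size a + RegularTree.size (l a) + 1))
        fun c hc => ?_).trans ?_
      · obtain ⟨b, hb, rfl⟩ := List.mem_map.1 hc
        refine (hp (a, b)).trans (eval_mono _ ?_)
        have := size_le_of_mem (hl'.subset hb)
        simp only [size_pair]
        omega
      · gcongr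
        rw [List.length_map]
        exact hl'.length_le.trans (length_le_size _)
  have h' := h.reverse
  simpa only [e, List.reverse_reverse] using h'

@[fun_prop]
theorem range {n : α → ℕ} (hn : PolyTime n) : PolyTime fun a => List.range (n a) := by
  have e : ∀ i, (fun s : ℕ × List ℕ => (s.1 + 1, s.1 :: s.2))^[i] (0, []) =
      (i, (List.range i).reverse) := by
    intro i
    induction i with
    | zero => rfl
    | succ i ih => simp only [Function.iterate_succ_apply', ih, List.range_succ]; simp
  have hn' := polyBdd_of_polyTime hn
  have h := iterate (g := fun _ (s : ℕ × List ℕ) => (s.1 + 1, s.1 :: s.2)) hn (const (0, []))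
    (by fun_prop) ((((PolyBdd.const 2).mul hn').add (.const 3)).add
      (hn'.mul (((PolyBdd.const 2).mul hn').add (.const 2)))) fun a i hi => by
      rw [e, size_pair, size_reverse, size_nat]
      have h1 : RegularTree.size (List.range i) ≤ i * (2 * n a + 2) + 1 := by
        refine (size_list_le (m := 2 * n a + 1) fun j hj => ?_).trans (by simp)
        have := List.mem_range.1 hj
        rw [size_nat]; omega
      have h2 := Nat.mul_le_mul_right (2 * n a + 2) hi
      omega
  have h' := h.proj_snd.reverse
  simpa only [e, List.reverse_reverse] using h'

@[fun_prop]
theorem drop {l : α → List β} {n : α → ℕ} (hl : PolyTime l) (hn : PolyTime n) :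
    PolyTime fun a => (l a).drop (n a) := by
  have e : ∀ (l : List β) (i : ℕ), (fun l => List.tail l)^[i] l = l.drop i := by
    intro l i
    induction i with
    | zero => rfl
    | succ i ih => rw [Function.iterate_succ_apply', ih, List.tail_drop]
  have h := iterate (g := fun _ (l : List β) => l.tail) hn hl (by fun_prop) hl.size fun a i hi => by
    rw [e]
    have h1 := size_append ((l a).take i) ((l a).drop i)
    have h2 := one_le_size ((l a).take i)
    rw [List.take_append_drop] at h1
    omega
  simpa only [e] using h

@[fun_prop]
theorem getD {l : α → List β} {n : α → ℕ} {d : α → β} (hl : PolyTime l) (hn : PolyTime n)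
    (hd : PolyTime d) : PolyTime fun a => (l a).getD (n a) (d a) := by
  refine ((hl.drop hn).headD hd).recode _root_.id (fun _ => rfl) fun a => congrArg _ ?_
  simp only [_root_.id, List.getD_eq_getElem?_getD, List.headD_eq_head?_getD, List.head?_drop]

@[fun_prop]
theorem all {l : α → List β} {p : α → β → Bool} (hl : PolyTime l)
    (hp : PolyTime fun x : α × β => p x.1 x.2) : PolyTime fun a => (l a).all (p a) := by
  have e : ∀ (p : β → Bool) (l : List β), l.foldl (fun c b => c && p b) true = l.all p := by
    intro p l
    induction l using List.reverseRecOn <;> simp_all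
  have h := foldl (g := fun a c b => c && p a b) hl (const true)
    (PolyTime.band (by fun_prop)
      (hp.comp (g := fun x : α × Bool × β => (x.1, x.2.2)) (by fun_prop))) (PolyBdd.const 3)
      fun a l' _ => size_bool_le _
  simpa only [e] using h

end PolyTime

end

end RegularTree

/-! ### The algorithm -/

namespace RegularTree

/-! #### Numbers in binary -/

/-- The binary representation of `n` modulo `2 ^ L`, least significant bit first. -/
def bitsOf : ℕ → ℕ → List Bool
  | 0, _ => []
  | L + 1, n => n.bodd :: bitsOf L n.div2

theorem bitsOf_injOn {L m n : ℕ} (hm : m < 2 ^ L) (hn : n < 2 ^ L)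
    (h : bitsOf L m = bitsOf L n) : m = n := by
  induction L generalizing m n with
  | zero => simp at hm hn; omega
  | succ L ih =>
    simp only [bitsOf, List.cons.injEq] at h
    have hm' := Nat.bodd_add_div2 m
    have hn' := Nat.bodd_add_div2 n
    have := ih (m := m.div2) (n := n.div2) (by rw [pow_succ] at hm; omega)
      (by rw [pow_succ] at hn; omega) h.2
    rw [← hm', ← hn', h.1, this]

/-- One step of the school method for addition. The state consists of the carry, the remaining bits
of the second summand, and the reversed list of the bits of the sum found so far. -/
def addStep (s : Bool × List Bool × List Bool) (b : Bool) : Bool × List Bool × List Bool :=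
  (b && s.2.1.headD false || s.1 && (b || s.2.1.headD false), s.2.1.tail,
    xor (xor b (s.2.1.headD false)) s.1 :: s.2.2)

/-- Addition of binary numbers; the sum has the length of the first summand. -/
def addBits (x y : List Bool) : List Bool := (x.foldl addStep (false, y, [])).2.2.reverse

theorem foldl_addStep_bitsOf (L m n : ℕ) (c : Bool) (z : List Bool) :
    ((bitsOf L m).foldl addStep (c, bitsOf L n, z)).2.2 =
      (bitsOf L (m + n + c.toNat)).reverse ++ z := by
  induction L generalizing m n c z with
  | zero => rfl
  | succ L ih =>
    have hm := Nat.bodd_add_div2 m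
    have hn := Nat.bodd_add_div2 n
    have h := Nat.bodd_add_div2 (m + n + c.toNat)
    simp only [bitsOf, List.foldl_cons, addStep, List.headD_cons, List.tail_cons, ih,
      List.reverse_cons, List.append_assoc, List.singleton_append]
    have h1 : (m + n + c.toNat).bodd = xor (xor m.bodd n.bodd) c := by
      rw [Nat.bodd_add, Nat.bodd_add]
      cases c <;> rfl
    rw [h1] at h ⊢
    congr 4
    cases h2 : m.bodd <;> cases h3 : n.bodd <;> cases c <;> simp_all <;> omega

theorem addBits_bitsOf (L m n : ℕ) : addBits (bitsOf L m) (bitsOf L n) = bitsOf L (m + n) := by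
  simp [addBits, foldl_addStep_bitsOf]

theorem length_foldl_addStep (x : List Bool) (s : Bool × List Bool × List Bool) :
    (x.foldl addStep s).2.2.length = x.length + s.2.2.length := by
  induction x generalizing s with
  | nil => simp
  | cons b x ih => rw [List.foldl_cons, ih]; simp [addStep]; omega

@[simp] theorem length_addBits (x y : List Bool) : (addBits x y).length = x.length := by
  simp [addBits, length_foldl_addStep]

theorem size_bits_le (x : List Bool) : size x ≤ 4 * x.length + 1 := by
  have := size_list_le (l := x) (m := 3) fun b _ => size_bool_le b
  omega

/-- The number `b` (`0` or `1`) in `L + 1` bits. -/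
def unitBits (L : ℕ) (b : Bool) : List Bool := b :: (List.range L).map fun _ => false

@[simp] theorem length_unitBits (L : ℕ) (b : Bool) : (unitBits L b).length = L + 1 := by
  simp [unitBits]

theorem unitBits_eq (L : ℕ) (b : Bool) : unitBits L b = bitsOf (L + 1) b.toNat := by
  have h : ∀ L, (List.range L).map (fun _ => false) = bitsOf L 0 := by
    intro L
    induction L with
    | zero => rfl
    | succ L ih =>
      rw [bitsOf, Nat.div2_zero, ← ih, List.range_succ_eq_map]
      simp [Function.comp_def]
  cases b <;> simp [unitBits, bitsOf, h]

/-- One step of the comparison of two bit strings. The state consists of the remaining bits of the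
second string and the result for the bits read so far. -/
def eqStep (s : List Bool × Bool) (b : Bool) : List Bool × Bool :=
  (s.1.tail, s.2 && !s.1.isEmpty && (s.1.headD false == b))

/-- Equality of bit strings, tested by one pass over the first. -/
def eqBits (x y : List Bool) : Bool :=
  (x.foldl eqStep (y, true)).2 && (x.foldl eqStep (y, true)).1.isEmpty

theorem eqBits_iff {x y : List Bool} : eqBits x y = true ↔ x = y := by
  have h0 : ∀ x y : List Bool, (x.foldl eqStep (y, false)).2 = false := by
    intro x
    induction x with
    | nil => intro y; rfl
    | cons b x ih => intro y; exact ih _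
  unfold eqBits
  induction x generalizing y with
  | nil => cases y <;> simp
  | cons b x ih =>
    rw [List.foldl_cons]
    cases y with
    | nil =>
      have : eqStep ([], true) b = ([], false) := rfl
      simp [this, h0]
    | cons c y =>
      have : eqStep (c :: y, true) b = (y, c == b) := by simp [eqStep]
      rw [this]
      by_cases hbc : c = b
      · subst hbc
        simpa using ih (y := y)
      · have : (c == b) = false := by simpa using hbc
        simp [this, h0, Ne.symm hbc]

/-! #### Partition refinement -/

/-- The sum of the numbers in the table `G`, in `L + 1` bits, over a row of a transition table;
the entry `0` of the row contributes nothing and the entry `i + 1` refers to the state `i`. -/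
def sumRow (L : ℕ) (G : List (List Bool)) (row : List ℕ) : List Bool :=
  row.foldl (fun acc e => addBits acc ((unitBits L false :: G).getD e (unitBits L false)))
    (unitBits L false)

/-- From the table of the numbers of words of length less than `n` that lead from each state to a
state in `T` with no final state before, compute the table for `n + 1`. -/
def countStep (L : ℕ) (fl : List Bool) (rows : List (List ℕ)) (T : List Bool)
    (G : List (List Bool)) : List (List Bool) :=
  (List.range rows.length).map fun x =>
    bif fl.getD x false then unitBits L (T.getD x false) else sumRow L G (rows.getD x [])

/-- The table of the numbers of words of length less than `n` that lead from each state to a state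
in `T` with no final state before. The empty table at the start stands for zeros, which are the
default value of a missing entry. -/
def countTable (L : ℕ) (fl : List Bool) (rows : List (List ℕ)) (T : List Bool) (n : ℕ) :
    List (List Bool) :=
  (countStep L fl rows T)^[n] []

/-- For each state, the number of its children whose state is in `T`; the empty bit string stands
for infinity. With `N` states, the number is infinite if and only if the children of length at most
`N + 1` are not as many as those of length at most `2 * N + 2`. -/
def signature (L : ℕ) (fl : List Bool) (rows : List (List ℕ)) (T : List Bool) :
    List (List Bool) :=
  (List.range rows.length).map fun q =>
    bif eqBits (sumRow L (countTable L fl rows T (rows.length + 1)) (rows.getD q []))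
      (sumRow L (countTable L fl rows T (2 * rows.length + 2)) (rows.getD q []))
    then sumRow L (countTable L fl rows T (rows.length + 1)) (rows.getD q []) else []

/-- One round of the refinement of an equivalence relation on the states, which is given by its
matrix. -/
def refineStep (L : ℕ) (fl : List Bool) (rows : List (List ℕ)) (E : List (List Bool)) :
    List (List Bool) :=
  (List.range rows.length).map fun i => (List.range rows.length).map fun j =>
    (E.getD i []).getD j false &&
      (E.map (signature L fl rows)).all fun s => eqBits (s.getD i []) (s.getD j [])

/-- The coarsest stable equivalence relation. -/
def stablePartition (L : ℕ) (fl : List Bool) (rows : List (List ℕ)) : List (List Bool) :=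
  (refineStep L fl rows)^[rows.length * rows.length]
    ((List.range rows.length).map fun _ => (List.range rows.length).map fun _ => true)

/-! #### Reading the input -/

/-- The inverse of `natsToBits`. -/
def bitsToNats (w : List Bool) : List ℕ :=
  (w.foldl (fun (s : ℕ × List ℕ) b => bif b then (s.1 + 1, s.2) else (0, s.1 :: s.2))
    (0, [])).2.reverse

theorem bitsToNats_natsToBits (l : List ℕ) : bitsToNats (natsToBits l) = l := by
  have h1 : ∀ (n m : ℕ) (z : List ℕ), (List.replicate n true).foldl
      (fun (s : ℕ × List ℕ) b => bif b then (s.1 + 1, s.2) else (0, s.1 :: s.2)) (m, z) =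
        (m + n, z) := by
    intro n
    induction n with
    | zero => intro m z; rfl
    | succ n ih =>
      intro m z
      rw [List.replicate_succ, List.foldl_cons, cond_true, ih]
      congr 1
      omega
  have h2 : ∀ (l z : List ℕ), (natsToBits l).foldl
      (fun (s : ℕ × List ℕ) b => bif b then (s.1 + 1, s.2) else (0, s.1 :: s.2)) (0, z) =
        (0, l.reverse ++ z) := by
    intro l
    induction l with
    | nil => intro z; rfl
    | cons m l ih =>
      intro z
      have : natsToBits (m :: l) = List.replicate m true ++ (false :: natsToBits l) := by
        simp [natsToBits]
      rw [this, List.foldl_append, h1, List.foldl_cons, cond_false, ih]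
      simp
  simp [bitsToNats, h2]

/-- The flags of the final states of the automaton described at position `o` of `l`. -/
def flagsAt (l : List ℕ) (o : ℕ) : List Bool :=
  (List.range (l.getD o 0)).map fun i => l.getD (o + (3 + i)) 0 == 1

/-- The transition table of the automaton described at position `o` of `l`, with the numbers of the
states increased by `d`. -/
def rowsAt (l : List ℕ) (o d : ℕ) : List (List ℕ) :=
  (List.range (l.getD o 0)).map fun i => (List.range (l.getD (o + 1) 0)).map fun a =>
    bif l.getD (o + (3 + (l.getD o 0 + (i * l.getD (o + 1) 0 + a)))) 0 == 0 then 0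
    else l.getD (o + (3 + (l.getD o 0 + (i * l.getD (o + 1) 0 + a)))) 0 + d

/-- The position at which the description of the second automaton begins. -/
def secondAt (l : List ℕ) : ℕ := 3 + (l.getD 0 0 + l.getD 0 0 * l.getD 1 0)

/-- A number of bits that suffices for all numbers that the algorithm computes. -/
def bitLength (l : List ℕ) : ℕ :=
  (l.getD 1 0 + l.getD (secondAt l + 1) 0) * (2 * (l.getD 0 0 + l.getD (secondAt l) 0) + 3)

/-- The decision procedure, on the sequence of numbers that describes two automata. -/
def decideIsoNats (l : List ℕ) : Bool :=
  ((stablePartition (bitLength l) (flagsAt l 0 ++ flagsAt l (secondAt l))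
    (rowsAt l 0 0 ++ rowsAt l (secondAt l) (l.getD 0 0))).getD (l.getD 2 0) []).getD
      (l.getD 0 0 + l.getD (secondAt l + 2) 0) false

/-- The decision procedure, on bit strings. -/
def decideIso (w : List Bool) : Bool := decideIsoNats (bitsToNats w)

/-! #### The algorithm runs in polynomial time -/

namespace PolyTime

section

variable {α : Type} [Enc α] {L n o d : α → ℕ} {x y fl T : α → List Bool}
  {G E : α → List (List Bool)} {row l : α → List ℕ} {rows : α → List (List ℕ)} {b : α → Bool}

@[fun_prop]
theorem addBits (hx : PolyTime x) (hy : PolyTime y) :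
    PolyTime fun a => addBits (x a) (y a) := by
  have h1 : ∀ (x : List Bool) (s : Bool × List Bool × List Bool),
      RegularTree.size (x.foldl addStep s).2.1 ≤ RegularTree.size s.2.1 := by
    intro x
    induction x with
    | nil => intro s; rfl
    | cons b x ih => intro s; exact (ih _).trans (size_tail_le _)
  have h := foldl (g := fun _ s b => addStep s b) (s := fun a => (false, y a, [])) hx
    (by fun_prop) (by unfold addStep; fun_prop)
    (((PolyBdd.const 4).mul hx.size).add (hy.size.add (.const 6))) fun a l' hl' => by
      have h2 := h1 l' (false, y a, [])
      have h3 := length_foldl_addStep l' (false, y a, [])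
      have h4 := hl'.length_le
      have h5 := length_le_size (x a)
      have h6 := size_bool_le (l'.foldl addStep (false, y a, [])).1
      have h7 := size_bits_le (l'.foldl addStep (false, y a, [])).2.2
      change RegularTree.size ((l'.foldl addStep (false, y a, [])).1,
        (l'.foldl addStep (false, y a, [])).2.1, (l'.foldl addStep (false, y a, [])).2.2) ≤ _
      simp only [size_pair, List.length_nil] at *
      omega
  exact h.proj_snd.proj_snd.reverse

@[fun_prop]
theorem unitBits (hL : PolyTime L) (hb : PolyTime b) : PolyTime fun a => unitBits (L a) (b a) := by
  unfold RegularTree.unitBits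
  fun_prop

@[fun_prop]
theorem eqBits (hx : PolyTime x) (hy : PolyTime y) : PolyTime fun a => eqBits (x a) (y a) := by
  have h1 : ∀ (x : List Bool) (s : List Bool × Bool),
      RegularTree.size (x.foldl eqStep s).1 ≤ RegularTree.size s.1 := by
    intro x
    induction x with
    | nil => intro s; rfl
    | cons b x ih => intro s; exact (ih _).trans (size_tail_le _)
  have h := foldl (g := fun _ s b => eqStep s b) (s := fun a => (y a, true)) hx
    (by fun_prop) (by unfold eqStep; fun_prop) (hy.size.add (.const 4)) fun a l' _ => by
      have h2 := h1 l' (y a, true)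
      have h3 := size_bool_le (l'.foldl eqStep (y a, true)).2
      change RegularTree.size ((l'.foldl eqStep (y a, true)).1,
        (l'.foldl eqStep (y a, true)).2) ≤ _
      simp only [size_pair] at *
      omega
  exact h.proj_snd.band h.proj_fst.isEmpty

theorem _root_.RegularTree.length_sumRow (L : ℕ) (G : List (List Bool)) (row : List ℕ) :
    (sumRow L G row).length = L + 1 := by
  unfold sumRow
  induction row using List.reverseRecOn <;> simp_all

theorem _root_.RegularTree.size_sumRow_le (L : ℕ) (G : List (List Bool)) (row : List ℕ) :
    RegularTree.size (sumRow L G row) ≤ 4 * L + 5 := by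
  have := size_bits_le (sumRow L G row)
  rw [length_sumRow] at this
  omega

@[fun_prop]
theorem sumRow (hL : PolyTime L) (hG : PolyTime G) (hrow : PolyTime row) :
    PolyTime fun a => sumRow (L a) (G a) (row a) :=
  foldl hrow (by fun_prop) (by fun_prop) (((PolyBdd.const 4).mul (polyBdd_of_polyTime hL)).add
    (.const 5)) fun _ _ _ => size_sumRow_le _ _ _

@[fun_prop]
theorem countStep (hL : PolyTime L) (hfl : PolyTime fl) (hrows : PolyTime rows) (hT : PolyTime T)
    (hG : PolyTime G) : PolyTime fun a => countStep (L a) (fl a) (rows a) (T a) (G a) := by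
  unfold RegularTree.countStep
  fun_prop

theorem _root_.RegularTree.size_countStep_le (L : ℕ) (fl : List Bool) (rows : List (List ℕ))
    (T : List Bool) (G : List (List Bool)) :
    RegularTree.size (RegularTree.countStep L fl rows T G) ≤
      RegularTree.size rows * (4 * L + 6) + 1 := by
  refine (size_list_le (m := 4 * L + 5) fun z hz => ?_).trans ?_
  · obtain ⟨x, -, rfl⟩ := List.mem_map.1 hz
    cases fl.getD x false
    · exact size_sumRow_le _ _ _
    · have := size_bits_le (RegularTree.unitBits L (T.getD x false))
      rw [length_unitBits] at this
      exact this.trans (by omega)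
  · have := Nat.mul_le_mul_right (4 * L + 6) (length_le_size rows)
    simpa [RegularTree.countStep] using this

@[fun_prop]
theorem countTable (hL : PolyTime L) (hfl : PolyTime fl) (hrows : PolyTime rows)
    (hT : PolyTime T) (hn : PolyTime n) :
    PolyTime fun a => countTable (L a) (fl a) (rows a) (T a) (n a) :=
  iterate_of_bdd hn (const []) (by fun_prop)
    ((hrows.size.mul (((PolyBdd.const 4).mul (polyBdd_of_polyTime hL)).add (.const 6))).add
      (.const 1)) fun _ _ => size_countStep_le _ _ _ _ _

@[fun_prop]
theorem signature (hL : PolyTime L) (hfl : PolyTime fl) (hrows : PolyTime rows)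
    (hT : PolyTime T) : PolyTime fun a => signature (L a) (fl a) (rows a) (T a) := by
  unfold RegularTree.signature
  fun_prop

@[fun_prop]
theorem refineStep (hL : PolyTime L) (hfl : PolyTime fl) (hrows : PolyTime rows)
    (hE : PolyTime E) : PolyTime fun a => refineStep (L a) (fl a) (rows a) (E a) := by
  unfold RegularTree.refineStep
  fun_prop

theorem _root_.RegularTree.size_refineStep_le (L : ℕ) (fl : List Bool) (rows : List (List ℕ))
    (E : List (List Bool)) :
    RegularTree.size (RegularTree.refineStep L fl rows E) ≤
      RegularTree.size rows * (4 * RegularTree.size rows + 2) + 1 := by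
  have h0 := length_le_size rows
  refine (size_list_le (m := 4 * RegularTree.size rows + 1) fun z hz => ?_).trans ?_
  · obtain ⟨x, -, rfl⟩ := List.mem_map.1 hz
    refine (size_bits_le _).trans ?_
    rw [List.length_map, List.length_range]
    omega
  · have := Nat.mul_le_mul_right (4 * RegularTree.size rows + 2) h0
    simpa [RegularTree.refineStep] using this

@[fun_prop]
theorem stablePartition (hL : PolyTime L) (hfl : PolyTime fl) (hrows : PolyTime rows) :
    PolyTime fun a => stablePartition (L a) (fl a) (rows a) :=
  iterate_of_bdd (by fun_prop) (by fun_prop) (by fun_prop)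
    ((hrows.size.mul (((PolyBdd.const 4).mul hrows.size).add (.const 2))).add (.const 1))
    fun _ _ => size_refineStep_le _ _ _ _

@[fun_prop]
theorem bitsToNats (hx : PolyTime x) : PolyTime fun a => bitsToNats (x a) := by
  have h0 : ∀ w : List Bool, RegularTree.size (w.foldl (fun (s : ℕ × List ℕ) b =>
      bif b then (s.1 + 1, s.2) else (0, s.1 :: s.2)) (0, [])) ≤ 2 * w.length + 3 := by
    intro w
    induction w using List.reverseRecOn with
    | nil => simp
    | append_singleton w b ih =>
      rw [List.foldl_append, List.foldl_cons, List.foldl_nil, List.length_append]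
      generalize w.foldl _ _ = s at ih ⊢
      obtain ⟨m, z⟩ := s
      cases b <;> simp at ih ⊢ <;> omega
  have h := foldl (g := fun _ (s : ℕ × List ℕ) b =>
    bif b then (s.1 + 1, s.2) else (0, s.1 :: s.2)) hx (const (0, [])) (by fun_prop)
    (((PolyBdd.const 2).mul hx.size).add (.const 3)) fun a l' hl' => by
      have h1 := h0 l'
      have h2 := hl'.length_le
      have h3 := length_le_size (x a)
      omega
  exact h.proj_snd.reverse

@[fun_prop]
theorem flagsAt (hl : PolyTime l) (ho : PolyTime o) : PolyTime fun a => flagsAt (l a) (o a) := by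
  unfold RegularTree.flagsAt
  fun_prop

@[fun_prop]
theorem rowsAt (hl : PolyTime l) (ho : PolyTime o) (hd : PolyTime d) :
    PolyTime fun a => rowsAt (l a) (o a) (d a) := by
  unfold RegularTree.rowsAt
  fun_prop

@[fun_prop]
theorem secondAt (hl : PolyTime l) : PolyTime fun a => secondAt (l a) := by
  unfold RegularTree.secondAt
  fun_prop

@[fun_prop]
theorem bitLength (hl : PolyTime l) : PolyTime fun a => bitLength (l a) := by
  unfold RegularTree.bitLength
  fun_prop

@[fun_prop]
theorem decideIsoNats (hl : PolyTime l) : PolyTime fun a => decideIsoNats (l a) := by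
  unfold RegularTree.decideIsoNats
  fun_prop

end

theorem _root_.RegularTree.polyTime_decideIso : PolyTime decideIso := by
  unfold decideIso
  fun_prop

end PolyTime

end RegularTree

/-! ### From polynomial-time functions to Turing machines -/

namespace RegularTree

/-- Replace the bits on the stack `aux` by the code of the list of these bits on `main`. -/
def Prog.load : Prog :=
  .seq (.pour .aux .tmp) (.seq (.push .main false) (.popLoop .tmp Option.isSome
    (.cases .skip (.seq (.push .main false) (.push .main true))
      (.seq (.push .main false) (.seq (.push .main false) (.seq (.push .main true)
        (.push .main true)))))))

theorem Exec.load (w : List Bool) :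
    Exec .load (stk [] w [] []) (stk (enc w).code [] [] []) (11 * w.length + 5) := by
  have key : ∀ (b z : List Bool), Iter .tmp Option.isSome (.cases .skip
      (.seq (.push .main false) (.push .main true))
      (.seq (.push .main false) (.seq (.push .main false) (.seq (.push .main true)
        (.push .main true))))) (stk (enc z).code [] b []) (stk (enc (b.reverse ++ z)).code [] [] [])
      (7 * b.length + 1) := by
    intro b
    induction b with
    | nil =>
      intro z
      simpa using Iter.done (k := .tmp) (S := stk (enc z).code [] [] []) (c := Option.isSome) rfl
    | cons x b ih =>
      intro z
      have h := ih (x :: z)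
      simp only [List.reverse_cons, List.append_assoc, List.singleton_append]
      refine (Iter.step (r₁ := some x) (t₁ := 5) (by simp) ?_ h).weaken
        (by simp only [List.length_cons]; omega)
      cases x
      · have h1 := ((Run.push (k := .main) (b := false) (r := some false)
          (S := stk (enc z).code [] b [])).seq (.push (k := .main) (b := true))).casesFalse
          (pn := .skip) (pt := (.seq (.push .main false) (.seq (.push .main false)
            (.seq (.push .main true) (.push .main true)))))
        simpa [enc_cons, enc_false, Dat.code] using h1.weaken (t' := 5) (by omega)
      · have h1 := ((Run.push (k := .main) (b := false) (r := some true)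
          (S := stk (enc z).code [] b [])).seq ((Run.push (k := .main) (b := false)).seq
          ((Run.push (k := .main) (b := true)).seq (.push (k := .main) (b := true))))).casesTrue
          (pn := .skip) (pf := .seq (.push .main false) (.push .main true))
        simpa [enc_cons, enc_true, Dat.code] using h1
  have h := (key w.reverse []).exec
  simp only [List.reverse_reverse, List.append_nil, List.length_reverse] at h
  refine ((Exec.pour_aux_tmp [] w [] []).seq (Exec.seq (Exec.push.of_eq rfl ?_ le_rfl) h)).weaken
    (by omega)
  simp [enc_nil, Dat.code]

/-- Move a bit, given by its code, from `main` to `tmp`. -/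
def Prog.output : Prog :=
  .branch .main (.push .tmp false) (.seq (.pop .main) (.seq (.pop .main) (.push .tmp true)))

theorem Exec.output (b : Bool) :
    Exec .output (stk (enc b).code [] [] []) (stk [] [] [b] []) 5 := by
  cases b
  · refine (Exec.branch_false (s := []) rfl (t := 1) ?_).weaken (by omega)
    simpa using Exec.push (k := .tmp) (b := false) (S := stk [] [] [] [])
  · refine Exec.branch_true (s := [false, false]) rfl (t := 3) fun r => ⟨some false, ?_⟩
    have h := (Run.pop (k := .main) (r := r) (S := stk [false, false] [] [] [])).seq
      ((Run.pop (k := .main)).seq (.push (k := .tmp) (b := true)))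
    simpa [enc_true, Dat.code] using h

/-- A decision problem is solvable in polynomial time if it is decided by a function on bit strings
that is computed by a stack program in polynomial time. -/
theorem solvableInPolyTime_of_polyTime {α : Type} {e : α → List Bool} {P : α → Prop}
    {f : List Bool → Bool} (hf : PolyTime f) (h : ∀ x, f (e x) = true ↔ P x) :
    SolvableInPolyTime e P := by
  obtain ⟨p, t, ⟨q, hq⟩, -, hp⟩ := hf
  refine solvableInPolyTime_of_run (.seq .load (.seq p .output))
    (11 * .X + 10 + q.comp (4 * .X + 1)) (fun x => f (e x)) h fun x => ?_
  have h1 := hp (e x) []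
  simp only [List.append_nil] at h1
  obtain ⟨r, hr⟩ := ((Exec.load (e x)).seq (h1.seq (Exec.output _))) none
  refine ⟨r, hr.weaken ?_⟩
  have h2 := (hq (e x)).trans (eval_mono q (size_bits_le (e x)))
  simp
  omega

end RegularTree

/-! ### Trees of accepted words -/

namespace RegularTree

/-- The prefix order on a set of words. -/
def prefixRel {α : Type} (S : Set (List α)) (u w : S) : Prop := (u : List α) <+: (w : List α)

/-- A relation that is total on both sides and preserves and reflects the prefix order is an
isomorphism; it is functional and injective because the prefix order is antisymmetric. -/
theorem nonempty_relIso_of_rel {α β : Type} {S : Set (List α)} {S' : Set (List β)}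
    (R : List α → List β → Prop) (h₁ : ∀ w ∈ S, ∃ w' ∈ S', R w w')
    (h₂ : ∀ w' ∈ S', ∃ w ∈ S, R w w')
    (h : ∀ u u' w w', R u u' → R w w' → (u <+: w ↔ u' <+: w')) :
    Nonempty (prefixRel S ≃r prefixRel S') := by
  choose f hf hfR using h₁
  choose g hg hgR using h₂
  refine ⟨⟨⟨fun w => ⟨f w w.2, hf _ _⟩, fun w => ⟨g w w.2, hg _ _⟩, fun w => ?_, fun w => ?_⟩, ?_⟩⟩
  · have a := hfR w.1 w.2
    have b := hgR _ (hf w.1 w.2)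
    exact Subtype.ext (((h _ _ _ _ b a).2 (List.prefix_refl _)).eq_of_length_le
      ((h _ _ _ _ a b).2 (List.prefix_refl _)).length_le)
  · have a := hgR w.1 w.2
    have b := hfR _ (hg w.1 w.2)
    exact Subtype.ext (((h _ _ _ _ b a).1 (List.prefix_refl _)).eq_of_length_le
      ((h _ _ _ _ a b).1 (List.prefix_refl _)).length_le)
  · intro u w
    exact (h _ _ _ _ (hfR u.1 u.2) (hfR w.1 w.2)).symm

/-- A deterministic automaton with partial transitions, without a distinguished initial state. -/
structure PartialAutomaton (V α : Type) where
  step : V → α → Option V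
  final : V → Bool

namespace PartialAutomaton

variable {V α : Type} (M : PartialAutomaton V α)

/-- The state reached from a state by reading a word. -/
def eval : V → List α → Option V
  | v, [] => some v
  | v, a :: w => (M.step v a).bind fun y => eval y w

/-- The set of words accepted from the state `v`. -/
def lang (v : V) : Set (List α) := {w | ∃ q, M.eval v w = some q ∧ M.final q = true}

/-- The first final state on the path labelled by a word, if it is reached exactly at the end. -/
def hit : V → List α → Option V
  | v, [] => bif M.final v then some v else none
  | v, a :: w => bif M.final v then none else (M.step v a).bind fun y => hit y w

/-- The state of a child of the root in the tree of words accepted from `v`: the state at the end of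
the path labelled by a nonempty word, if this is the first final state on the path after the
start. -/
def child (v : V) : List α → Option V
  | [] => none
  | a :: w => (M.step v a).bind fun y => M.hit y w

/-- The children of the root whose states satisfy `T`. -/
def childSet (T : V → Prop) (v : V) : Set (List α) := {w | ∃ p, M.child v w = some p ∧ T p}

variable {M} {v v' p p' q : V} {c c' u w : List α}

theorem eval_append (v : V) (u w : List α) :
    M.eval v (u ++ w) = (M.eval v u).bind fun y => M.eval y w := by
  induction u generalizing v with
  | nil => rfl
  | cons a u ih =>
    simp only [List.cons_append, eval]
    cases M.step v a with
    | none => rfl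
    | some y => exact ih y

theorem nil_mem_lang (h : M.final v = true) : [] ∈ M.lang v := ⟨v, rfl, h⟩

theorem hit_spec (h : M.hit v w = some p) : M.eval v w = some p ∧ M.final p = true := by
  induction w generalizing v with
  | nil => cases hv : M.final v <;> simp_all [hit, eval]
  | cons a w ih =>
    cases hv : M.final v with
    | true => simp [hit, hv] at h
    | false =>
      cases hs : M.step v a with
      | none => simp [hit, hv, hs] at h
      | some y =>
        have := ih (v := y) (by simpa [hit, hv, hs] using h)
        simpa [eval, hs] using this

theorem child_spec (h : M.child v c = some p) :
    M.eval v c = some p ∧ M.final p = true ∧ c ≠ [] := by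
  cases c with
  | nil => simp [child] at h
  | cons a w =>
    cases hs : M.step v a with
    | none => simp [child, hs] at h
    | some y =>
      have := hit_spec (M := M) (v := y) (w := w) (p := p) (by simpa [child, hs] using h)
      simpa [eval, hs] using this

/-- An accepted word can be cut at the first final state on its path. -/
theorem exists_hit (h : M.eval v w = some q) (hq : M.final q = true) :
    ∃ c r p, w = c ++ r ∧ M.hit v c = some p ∧ M.eval p r = some q := by
  induction w generalizing v with
  | nil =>
    obtain rfl : v = q := by simpa [eval] using h
    exact ⟨[], [], v, rfl, by simp [hit, hq], rfl⟩
  | cons a w ih =>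
    cases hv : M.final v with
    | true => exact ⟨[], a :: w, v, rfl, by simp [hit, hv], h⟩
    | false =>
      cases hs : M.step v a with
      | none => simp [eval, hs] at h
      | some y =>
        obtain ⟨c, r, p, rfl, h1, h2⟩ := ih (v := y) (by simpa [eval, hs] using h)
        exact ⟨a :: c, r, p, rfl, by simp [hit, hv, hs, h1], h2⟩

theorem exists_child (h : w ∈ M.lang v) (hw : w ≠ []) :
    ∃ c r p, w = c ++ r ∧ M.child v c = some p ∧ r ∈ M.lang p := by
  obtain ⟨q, h, hq⟩ := h
  cases w with
  | nil => exact absurd rfl hw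
  | cons a w =>
    cases hs : M.step v a with
    | none => simp [eval, hs] at h
    | some y =>
      obtain ⟨c, r, p, rfl, h1, h2⟩ := exists_hit (v := y) (by simpa [eval, hs] using h) hq
      exact ⟨a :: c, r, p, rfl, by simp [child, hs, h1], q, h2, hq⟩

theorem hit_prefix (h : M.hit v c = some p) (hu : u <+: c) (hl : u ∈ M.lang v) : u = c := by
  induction c generalizing v u with
  | nil => exact List.prefix_nil.1 hu
  | cons a c ih =>
    cases hv : M.final v with
    | true => simp [hit, hv] at h
    | false =>
      obtain ⟨q, he, hq⟩ := hl
      cases u with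
      | nil =>
        obtain rfl : v = q := by simpa [eval] using he
        simp [hv] at hq
      | cons b u =>
        obtain ⟨rfl, hu'⟩ := List.cons_prefix_cons.1 hu
        cases hs : M.step v b with
        | none => simp [eval, hs] at he
        | some y =>
          rw [ih (v := y) (by simpa [hit, hv, hs] using h) hu'
            ⟨q, by simpa [eval, hs] using he, hq⟩]

theorem child_prefix (h : M.child v c = some p) (hu : u <+: c) (hl : u ∈ M.lang v) (hn : u ≠ []) :
    u = c := by
  obtain ⟨q, he, hq⟩ := hl
  cases u with
  | nil => exact absurd rfl hn
  | cons a u =>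
    cases c with
    | nil => simp at hu
    | cons b c =>
      obtain ⟨rfl, hu'⟩ := List.cons_prefix_cons.1 hu
      cases hs : M.step v a with
      | none => simp [eval, hs] at he
      | some y =>
        rw [hit_prefix (v := y) (by simpa [child, hs] using h) hu'
          ⟨q, by simpa [eval, hs] using he, hq⟩]

theorem child_mem_lang (h : M.child v c = some p) : c ∈ M.lang v :=
  ⟨p, (child_spec h).1, (child_spec h).2.1⟩

theorem append_mem_lang (h : M.child v c = some p) : c ++ w ∈ M.lang v ↔ w ∈ M.lang p := by
  simp [lang, eval_append, (child_spec h).1]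

/-- Children are the minimal nonempty accepted words. -/
theorem exists_child_eq (hc : c ∈ M.lang v) (hn : c ≠ [])
    (h : ∀ u ∈ M.lang v, u <+: c → u = [] ∨ u = c) : ∃ p, M.child v c = some p := by
  obtain ⟨d, r, p, e, h1, -⟩ := exists_child hc hn
  rcases h d (child_mem_lang h1) ⟨r, e.symm⟩ with h2 | h2
  · exact absurd h2 (child_spec h1).2.2
  · exact ⟨p, h2 ▸ h1⟩

variable (M) in
/-- The trees of words accepted from two states are isomorphic. -/
def TreeIso (v v' : V) : Prop := Nonempty (prefixRel (M.lang v) ≃r prefixRel (M.lang v'))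

theorem TreeIso.symm (h : M.TreeIso v v') : M.TreeIso v' v := h.map fun f => f.symm

/-! #### Isomorphic trees have equally many children of each kind -/

theorem relIso_nil (f : prefixRel (M.lang v) ≃r prefixRel (M.lang v')) (hv : M.final v = true)
    (hv' : M.final v' = true) : f ⟨[], nil_mem_lang hv⟩ = ⟨[], nil_mem_lang hv'⟩ := by
  have h : prefixRel _ (f ⟨[], nil_mem_lang hv⟩) (f (f.symm ⟨[], nil_mem_lang hv'⟩)) :=
    f.map_rel_iff.2 (List.nil_prefix)
  rw [f.apply_symm_apply] at h
  exact Subtype.ext (List.prefix_nil.1 h)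

/-- An isomorphism maps children to children and restricts to the subtrees above them. -/
theorem child_relIso (f : prefixRel (M.lang v) ≃r prefixRel (M.lang v')) (hv : M.final v = true)
    (hv' : M.final v' = true) (hc : M.child v c = some p) :
    ∃ p', M.child v' (f ⟨c, child_mem_lang hc⟩) = some p' ∧ M.TreeIso p p' := by
  have hnil := relIso_nil f hv hv'
  generalize hd : f ⟨c, child_mem_lang hc⟩ = d
  obtain ⟨d, hdl⟩ := d
  have hdn : d ≠ [] := by
    rintro rfl
    rw [← hnil] at hd
    exact (child_spec hc).2.2 (congrArg Subtype.val (f.injective hd))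
  obtain ⟨p', hp'⟩ := exists_child_eq hdl hdn fun u hu hud => by
    have h1 : prefixRel _ (f (f.symm ⟨u, hu⟩)) (f ⟨c, child_mem_lang hc⟩) := by
      rw [f.apply_symm_apply, hd]
      exact hud
    have h2 : prefixRel _ (f.symm ⟨u, hu⟩) ⟨c, child_mem_lang hc⟩ := f.map_rel_iff.1 h1
    by_cases h3 : (f.symm ⟨u, hu⟩).1 = []
    · left
      have h4 : f.symm ⟨u, hu⟩ = ⟨[], nil_mem_lang hv⟩ := Subtype.ext h3
      have h5 := congrArg f h4
      rw [f.apply_symm_apply, hnil] at h5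
      exact congrArg Subtype.val h5
    · right
      have h4 : f.symm ⟨u, hu⟩ = ⟨c, child_mem_lang hc⟩ :=
        Subtype.ext (child_prefix hc h2 (f.symm ⟨u, hu⟩).2 h3)
      have h5 := congrArg f h4
      rw [f.apply_symm_apply, hd] at h5
      exact congrArg Subtype.val h5
  refine ⟨p', hp', nonempty_relIso_of_rel (fun r r' => ∃ (h : c ++ r ∈ M.lang v)
    (h' : d ++ r' ∈ M.lang v'), f ⟨c ++ r, h⟩ = ⟨d ++ r', h'⟩) ?_ ?_ ?_⟩
  · intro r hr
    have h := (append_mem_lang hc).2 hr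
    have h1 : prefixRel _ (f ⟨c, child_mem_lang hc⟩) (f ⟨c ++ r, h⟩) :=
      f.map_rel_iff.2 (List.prefix_append c r)
    rw [hd] at h1
    obtain ⟨r', e⟩ := h1
    have h2 : d ++ r' ∈ M.lang v' := e ▸ (f ⟨c ++ r, h⟩).2
    exact ⟨r', (append_mem_lang hp').1 h2, h, h2, Subtype.ext e.symm⟩
  · intro r' hr'
    have h := (append_mem_lang hp').2 hr'
    have h1 : prefixRel _ (f ⟨c, child_mem_lang hc⟩) (f (f.symm ⟨d ++ r', h⟩)) := by
      rw [f.apply_symm_apply, hd]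
      exact List.prefix_append d r'
    obtain ⟨r, e⟩ := f.map_rel_iff.1 h1
    have h2 : c ++ r ∈ M.lang v := by
      have := (f.symm ⟨d ++ r', h⟩).2
      rwa [← e] at this
    refine ⟨r, (append_mem_lang hc).1 h2, h2, h, ?_⟩
    have e' : (⟨c ++ r, h2⟩ : M.lang v) = f.symm ⟨d ++ r', h⟩ := Subtype.ext e
    rw [e', f.apply_symm_apply]
  · rintro u u' w w' ⟨h1, h1', e1⟩ ⟨h2, h2', e2⟩
    have h := f.map_rel_iff (a := ⟨c ++ u, h1⟩) (b := ⟨c ++ w, h2⟩)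
    rw [e1, e2] at h
    simpa [prefixRel, List.prefix_append_right_inj] using h.symm

theorem TreeIso.encard_childSet_le {T : V → Prop} (h : M.TreeIso v v') (hv : M.final v = true)
    (hv' : M.final v' = true) (hT : ∀ p p', M.final p = true → M.final p' = true →
      M.TreeIso p p' → T p → T p') :
    (M.childSet T v).encard ≤ (M.childSet T v').encard := by
  obtain ⟨f⟩ := h
  refine Function.Embedding.encard_le ⟨fun w => ⟨f ⟨w.1, child_mem_lang w.2.choose_spec.1⟩, ?_⟩, ?_⟩
  · obtain ⟨w, p, h1, h2⟩ := w
    obtain ⟨p', h3, h4⟩ := child_relIso f hv hv' h1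
    exact ⟨p', h3, hT p p' (child_spec h1).2.1 (child_spec h3).2.1 h4 h2⟩
  · intro u w h
    have h0 := congrArg Subtype.val h
    have h1 := f.injective (Subtype.ext h0)
    exact Subtype.ext (Subtype.mk.inj h1)

/-! #### Stable equivalence relations yield isomorphisms -/

theorem nonempty_equiv_of_encard_eq {β : Type} [Countable β] {s t : Set β}
    (h : s.encard = t.encard) : Nonempty (s ≃ t) := by
  have h1 : Cardinal.toENat (Cardinal.mk s) = Cardinal.toENat (Cardinal.mk t) := h
  exact Cardinal.eq.1 (Cardinal.toENat_injOn Cardinal.mk_le_aleph0 Cardinal.mk_le_aleph0 h1)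

/-- If equivalent states have equally many children in each class, then the children of equivalent
states can be matched such that matching children have equivalent states. -/
theorem exists_matching [Countable α] {E : V → V → Prop} (hE : Equivalence E)
    (h : ∀ p, (M.childSet (E p) v).encard = (M.childSet (E p) v').encard) :
    ∃ B : List α → List α → Prop,
      (∀ c p, M.child v c = some p → ∃ c' p', M.child v' c' = some p' ∧ B c c' ∧ E p p') ∧
      (∀ c' p', M.child v' c' = some p' → ∃ c p, M.child v c = some p ∧ B c c' ∧ E p p') ∧
      (∀ c c₁ c₂, B c c₁ → B c c₂ → c₁ = c₂) ∧ (∀ c' c₁ c₂, B c₁ c' → B c₂ c' → c₁ = c₂) := by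
  have hcl : ∀ p p₀, {x | E p x} = {x | E p₀ x} ↔ E p₀ p := fun p p₀ =>
    ⟨fun e => (Set.ext_iff.1 e p).1 (hE.refl p), fun e => Set.ext fun x =>
      ⟨fun h => hE.trans e h, fun h => hE.trans (hE.symm e) h⟩⟩
  have h1 : ∀ S : Set V, Nonempty (M.childSet (fun p => {x | E p x} = S) v ≃
      M.childSet (fun p => {x | E p x} = S) v') := by
    intro S
    by_cases hS : ∃ p₀, {x | E p₀ x} = S
    · obtain ⟨p₀, rfl⟩ := hS
      simp only [hcl]
      exact nonempty_equiv_of_encard_eq (h p₀)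
    · refine ⟨@Equiv.equivOfIsEmpty _ _ ⟨?_⟩ ⟨?_⟩⟩ <;>
        exact fun ⟨w, p, _, hp⟩ => hS ⟨p, hp⟩
  obtain ⟨e⟩ := Classical.nonempty_pi.2 h1
  refine ⟨fun c c' => ∃ (S : _) (hc : _), (e S ⟨c, hc⟩ : List α) = c', ?_, ?_, ?_, ?_⟩
  · intro c p hp
    obtain ⟨p', h2, h3⟩ := (e {x | E p x} ⟨c, p, hp, rfl⟩).2
    exact ⟨_, p', h2, ⟨_, _, rfl⟩, (hcl _ _).1 h3⟩
  · intro c' p' hp'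
    obtain ⟨p, h2, h3⟩ := ((e {x | E p' x}).symm ⟨c', p', hp', rfl⟩).2
    refine ⟨_, p, h2, ⟨_, ((e {x | E p' x}).symm ⟨c', p', hp', rfl⟩).2, ?_⟩,
      hE.symm ((hcl _ _).1 h3)⟩
    simp
  · rintro c c₁ c₂ ⟨S, ⟨p, hp, rfl⟩, rfl⟩ ⟨S', ⟨p', hp', rfl⟩, rfl⟩
    obtain rfl : p = p' := Option.some.inj (hp.symm.trans hp')
    rfl
  · rintro c' c₁ c₂ ⟨S, hc₁, h₁⟩ ⟨S', hc₂, h₂⟩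
    obtain ⟨p, hp, rfl⟩ := (e S ⟨c₁, hc₁⟩).2
    obtain ⟨p', hp', rfl⟩ := (e S' ⟨c₂, hc₂⟩).2
    rw [h₁] at hp
    rw [h₂] at hp'
    obtain rfl : p = p' := Option.some.inj (hp.symm.trans hp')
    have := (e _).injective (Subtype.ext (h₁.trans h₂.symm))
    exact congrArg Subtype.val this

/-- The relation between words that arises from a matching `B` of children, applied along a path in
the tree. -/
inductive PathRel (M : PartialAutomaton V α) (B : V → V → List α → List α → Prop) :
    V → V → List α → List α → Prop
  | nil {v v' : V} : PathRel M B v v' [] []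
  | cons {v v' p p' : V} {c c' w w' : List α} : M.child v c = some p → M.child v' c' = some p' →
      B v v' c c' → PathRel M B p p' w w' → PathRel M B v v' (c ++ w) (c' ++ w')

theorem PathRel.flip {B : V → V → List α → List α → Prop} {w'} (h : M.PathRel B v v' w w') :
    M.PathRel (fun v v' c c' => B v' v c' c) v' v w' w := by
  induction h with
  | nil => exact .nil
  | cons h1 h2 h3 _ ih => exact .cons h2 h1 h3 ih

/-- If matching is functional, then the path relation preserves the prefix order, because a word has
only one decomposition into children. -/
theorem PathRel.prefix {B : V → V → List α → List α → Prop}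
    (hB : ∀ v v' c c₁ c₂, B v v' c c₁ → B v v' c c₂ → c₁ = c₂) {u' w'}
    (hu : M.PathRel B v v' u u') (hw : M.PathRel B v v' w w') (h : u <+: w) : u' <+: w' := by
  induction hu generalizing w w' with
  | nil => exact List.nil_prefix
  | @cons v v' p p' c c' u u' hp hp' hc _ ih =>
    cases hw with
    | nil => exact absurd (List.append_eq_nil_iff.1 (List.prefix_nil.1 h)).1 (child_spec hp).2.2
    | @cons _ _ p₁ p₁' c₁ c₁' w w' hp₁ hp₁' hc₁ hw =>
      -- Both children are prefixes of the same word, hence equal.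
      have h1 : c <+: c₁ ++ w := (List.prefix_append c u).trans h
      obtain rfl : c = c₁ := by
        rcases List.prefix_or_prefix_of_prefix h1 (List.prefix_append c₁ w) with h2 | h2
        · exact child_prefix hp₁ h2 (child_mem_lang hp) (child_spec hp).2.2
        · exact (child_prefix hp h2 (child_mem_lang hp₁) (child_spec hp₁).2.2).symm
      obtain rfl : p = p₁ := Option.some.inj (hp.symm.trans hp₁)
      obtain rfl : c' = c₁' := hB _ _ _ _ _ hc hc₁
      obtain rfl : p' = p₁' := Option.some.inj (hp'.symm.trans hp₁')
      rw [List.prefix_append_right_inj] at h ⊢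
      exact ih hw h

theorem PathRel.total {B : V → V → List α → List α → Prop} {E : V → V → Prop}
    (hB : ∀ v v', E v v' → ∀ c p, M.child v c = some p →
      ∃ c' p', M.child v' c' = some p' ∧ B v v' c c' ∧ E p p')
    (hE : E v v') (hv' : M.final v' = true) (hw : w ∈ M.lang v) :
    ∃ w' ∈ M.lang v', M.PathRel B v v' w w' := by
  induction hn : w.length using Nat.strong_induction_on generalizing v v' w with
  | _ n ih =>
    by_cases h0 : w = []
    · subst h0
      exact ⟨[], nil_mem_lang hv', .nil⟩
    · obtain ⟨c, r, p, rfl, hc, hr⟩ := exists_child hw h0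
      obtain ⟨c', p', hc', hcc, hpp⟩ := hB v v' hE c p hc
      have := List.length_pos_iff.2 (child_spec hc).2.2
      obtain ⟨r', hr', h⟩ := ih r.length (by rw [← hn, List.length_append]; omega) hpp
        (child_spec hc').2.1 hr rfl
      exact ⟨c' ++ r', (append_mem_lang hc').2 hr', .cons hc hc' hcc h⟩

/-- If equivalent states have equally many children in each class, then the trees of equivalent
final states are isomorphic. -/
theorem treeIso_of_stable [Countable α] {E : V → V → Prop} (hE : Equivalence E)
    (h : ∀ v v', E v v' → ∀ p, (M.childSet (E p) v).encard = (M.childSet (E p) v').encard)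
    (hvv : E v v') (hv : M.final v = true) (hv' : M.final v' = true) : M.TreeIso v v' := by
  choose B h1 h2 h3 h4 using fun v v' hvv => exists_matching hE (h v v' hvv)
  let B' : V → V → List α → List α → Prop := fun v v' c c' => ∃ hvv, B v v' hvv c c'
  have f1 : ∀ v v' c c₁ c₂, B' v v' c c₁ → B' v v' c c₂ → c₁ = c₂ :=
    fun v v' c c₁ c₂ ⟨e, b⟩ ⟨_, b'⟩ => h3 v v' e c c₁ c₂ b b'
  have f2 : ∀ v v' c c₁ c₂, B' v' v c₁ c → B' v' v c₂ c → c₁ = c₂ :=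
    fun v v' c c₁ c₂ ⟨e, b⟩ ⟨_, b'⟩ => h4 v' v e c c₁ c₂ b b'
  refine nonempty_relIso_of_rel (M.PathRel B' v v') (fun w hw => ?_) (fun w' hw' => ?_)
    fun u u' w w' hu hw => ⟨hu.prefix f1 hw, hu.flip.prefix f2 hw.flip⟩
  · refine PathRel.total (E := E) (fun v v' e c p hc => ?_) hvv hv' hw
    obtain ⟨c', p', a, b, d⟩ := h1 v v' e c p hc
    exact ⟨c', p', a, ⟨e, b⟩, d⟩
  · obtain ⟨w, hw, hr⟩ := PathRel.total (B := fun v v' c c' => B' v' v c' c)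
      (E := fun v v' => E v' v) (fun v v' e c p hc => by
        obtain ⟨c', p', a, b, d⟩ := h2 v' v e c p hc
        exact ⟨c', p', a, ⟨e, b⟩, d⟩) hvv hv hw'
    exact ⟨w, hw, hr.flip⟩

/-! #### Partition refinement computes the isomorphism relation -/

variable (M) in
/-- The relation after `n` rounds of refinement, which starts with all states being equivalent. Each
round separates the states that differ in the number of children in some class. -/
def refinement : ℕ → V → V → Prop
  | 0, _, _ => True
  | n + 1, v, v' => refinement n v v' ∧
      ∀ p, (M.childSet (refinement n p) v).encard = (M.childSet (refinement n p) v').encard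

theorem refinement_equivalence (n : ℕ) : Equivalence (M.refinement n) := by
  induction n with
  | zero => exact ⟨fun _ => trivial, fun _ => trivial, fun _ _ => trivial⟩
  | succ n ih =>
    exact ⟨fun v => ⟨ih.refl v, fun _ => rfl⟩, fun h => ⟨ih.symm h.1, fun p => (h.2 p).symm⟩,
      fun h h' => ⟨ih.trans h.1 h'.1, fun p => (h.2 p).trans (h'.2 p)⟩⟩

/-- States with isomorphic trees are never separated. -/
theorem TreeIso.refinement (n : ℕ) (h : M.TreeIso v v') (hv : M.final v = true)
    (hv' : M.final v' = true) : M.refinement n v v' := by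
  induction n generalizing v v' with
  | zero => trivial
  | succ n ih =>
    refine ⟨ih h hv hv', fun p => ?_⟩
    have hT : ∀ q q', M.final q = true → M.final q' = true → M.TreeIso q q' →
        M.refinement n p q → M.refinement n p q' := fun q q' hq hq' hqq hp =>
      (refinement_equivalence n).trans hp (ih hqq hq hq')
    exact le_antisymm (h.encard_childSet_le hv hv' hT) (h.symm.encard_childSet_le hv' hv hT)

/-- A decreasing sequence of subsets of a finite type in which each set determines the next one is
constant from the number of elements of the type on. -/
theorem eq_of_antitone {β : Type} [Fintype β] (S : ℕ → Finset β) (h : ∀ n, S (n + 1) ⊆ S n)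
    (h' : ∀ n, S (n + 1) = S n → S (n + 2) = S (n + 1)) :
    S (Fintype.card β + 1) = S (Fintype.card β) := by
  have key : ∀ n, S (n + 1) = S n ∨ (S n).card + n ≤ Fintype.card β := by
    intro n
    induction n with
    | zero => exact .inr (Finset.card_le_univ _)
    | succ n ih =>
      rcases ih with ih | ih
      · exact .inl (h' n ih)
      · by_cases e : S (n + 1) = S n
        · exact .inl (h' n e)
        · have := Finset.card_lt_card ((h n).ssubset_of_ne e)
          exact .inr (by omega)
  rcases key (Fintype.card β) with e | e
  · exact e
  · have e1 : S (Fintype.card β) = ∅ := Finset.card_eq_zero.1 (by omega)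
    have e2 := h (Fintype.card β)
    rw [e1] at e2 ⊢
    exact Finset.subset_empty.1 e2

/-- The trees of two final states are isomorphic if and only if the states are never separated by
the refinement, and the number of rounds can be bounded. -/
theorem treeIso_iff_refinement [Countable α] [Fintype V] (hv : M.final v = true)
    (hv' : M.final v' = true) :
    M.TreeIso v v' ↔ M.refinement (Fintype.card V * Fintype.card V) v v' := by
  classical
  refine ⟨fun h => h.refinement _ hv hv', fun h => ?_⟩
  let S : ℕ → Finset (V × V) := fun n => Finset.univ.filter fun x => M.refinement n x.1 x.2
  have hS : ∀ m n, S m = S n → M.refinement m = M.refinement n := by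
    intro m n e
    funext x y
    have := congrArg ((x, y) ∈ ·) e
    simpa [S] using this
  have e := hS _ _ (eq_of_antitone S
    (fun n x hx => by
      simp only [S, Finset.mem_filter, Finset.mem_univ, true_and] at hx ⊢
      exact hx.1)
    fun n e => by
      have e' := hS _ _ e
      ext x
      simp only [S, Finset.mem_filter, Finset.mem_univ, true_and]
      change (_ ∧ _) ↔ (_ ∧ _)
      rw [e'])
  rw [Fintype.card_prod] at e
  refine treeIso_of_stable (refinement_equivalence (Fintype.card V * Fintype.card V))
    (fun x y hxy => ?_) h hv hv'
  rw [← e] at hxy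
  exact hxy.2

end PartialAutomaton

end RegularTree

/-! ### Counting children -/

namespace RegularTree

namespace PartialAutomaton

variable {V α : Type} (M : PartialAutomaton V α)

/-- The sum of `g` over the successors of a state, one for each letter. -/
def succSum [Fintype α] (g : V → ℕ) (v : V) : ℕ := ∑ a, ((M.step v a).map g).getD 0

/-- The number of words of length less than `n` that lead from `v` to a state in `T` with no final
state before, defined by recursion. -/
def hitCount [Fintype α] (T : V → Bool) : ℕ → V → ℕ
  | 0, _ => 0
  | n + 1, v => bif M.final v then (T v).toNat else M.succSum (hitCount T n) v

/-- The words that lead from `v` to a state in `T` with no final state before. -/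
def hitSet (T : V → Bool) (v : V) : Set (List α) := {w | ∃ p, M.hit v w = some p ∧ T p = true}

variable {M} {T : V → Bool} {v y : V} {a : α} {w : List α}

theorem nil_mem_hitSet : [] ∈ M.hitSet T v ↔ M.final v = true ∧ T v = true := by
  cases h : M.final v <;> simp [hitSet, hit, h]

theorem cons_mem_hitSet :
    a :: w ∈ M.hitSet T v ↔ M.final v = false ∧ ∃ y, M.step v a = some y ∧ w ∈ M.hitSet T y := by
  cases h : M.final v <;> cases hs : M.step v a <;> simp [hitSet, hit, h, hs]

theorem cons_mem_childSet :
    a :: w ∈ M.childSet (fun p => T p = true) v ↔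
      ∃ y, M.step v a = some y ∧ w ∈ M.hitSet T y := by
  cases hs : M.step v a <;> simp [hitSet, childSet, child, hs]

theorem nil_notMem_childSet {T : V → Prop} : [] ∉ M.childSet T v := by simp [childSet, child]

/-- If a set `A` of words consists of the words `a :: w` with `w` in the set `S` of the successor
under `a`, then its words of length at most `n` are counted by `succSum`. -/
theorem encard_eq_succSum [Fintype α] {S : V → Set (List α)} {g : V → ℕ} {n : ℕ}
    (hg : ∀ y, {w | w ∈ S y ∧ w.length < n}.encard = g y) {A : Set (List α)} (hnil : [] ∉ A)
    (hcons : ∀ a w, a :: w ∈ A ↔ ∃ y, M.step v a = some y ∧ w ∈ S y) :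
    {w | w ∈ A ∧ w.length < n + 1}.encard = M.succSum g v := by
  have h1 : {w | w ∈ A ∧ w.length < n + 1} =
      ⋃ a : α, {w | ∃ u, w = a :: u ∧ w ∈ A ∧ w.length < n + 1} := by
    ext w
    cases w with
    | nil => simp [hnil]
    | cons a w => simp
  have h2 : ∀ a, {w | ∃ u, w = a :: u ∧ w ∈ A ∧ w.length < n + 1}.encard =
      (((M.step v a).map g).getD 0 : ℕ) := by
    intro a
    have h3 : {w | ∃ u, w = a :: u ∧ w ∈ A ∧ w.length < n + 1} =
        (a :: ·) '' {u | a :: u ∈ A ∧ u.length < n} := by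
      ext w
      constructor
      · rintro ⟨u, rfl, hu, hl⟩
        exact ⟨u, ⟨hu, by simpa using hl⟩, rfl⟩
      · rintro ⟨u, ⟨hu, hl⟩, rfl⟩
        exact ⟨u, rfl, hu, by simpa using hl⟩
    rw [h3, (List.cons_injective).encard_image]
    simp only [hcons]
    cases hs : M.step v a with
    | none => simp
    | some y => simpa using hg y
  rw [h1, Set.encard_iUnion_of_finite, finsum_eq_sum_of_fintype]
  · simp only [h2, succSum]
    push_cast
    rfl
  · intro a b hab
    refine Set.disjoint_left.2 ?_
    rintro w ⟨u, rfl, -⟩ ⟨u', e, -⟩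
    exact hab (List.cons.inj e).1

theorem encard_hitSet_lt [Fintype α] (n : ℕ) (v : V) :
    {w | w ∈ M.hitSet T v ∧ w.length < n}.encard = M.hitCount T n v := by
  induction n generalizing v with
  | zero => simp [hitCount]
  | succ n ih =>
    cases hv : M.final v with
    | false =>
      simp only [hitCount, hv, cond_false]
      exact encard_eq_succSum ih (by simp [nil_mem_hitSet, hv])
        fun a w => by simp [cons_mem_hitSet, hv]
    | true =>
      simp only [hitCount, hv, cond_true]
      cases hT : T v with
      | false =>
        convert Set.encard_empty
        · ext w
          cases w <;> simp [nil_mem_hitSet, cons_mem_hitSet, hv, hT]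
        · simp
      | true =>
        convert Set.encard_singleton ([] : List α)
        · ext w
          cases w <;> simp [nil_mem_hitSet, cons_mem_hitSet, hv, hT]
        · simp

theorem encard_childSet_lt [Fintype α] (n : ℕ) (v : V) :
    {w | w ∈ M.childSet (fun p => T p = true) v ∧ w.length < n + 1}.encard =
      M.succSum (M.hitCount T n) v :=
  encard_eq_succSum (encard_hitSet_lt n) nil_notMem_childSet fun _ _ => cons_mem_childSet

theorem succSum_lt [Fintype α] {g : V → ℕ} {m : ℕ} (h : ∀ y, g y < 2 ^ m) (v : V) :
    M.succSum g v < 2 ^ (m + Fintype.card α) := by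
  have h1 : M.succSum g v ≤ Fintype.card α * (2 ^ m - 1) := by
    refine (Finset.sum_le_card_nsmul _ _ (2 ^ m - 1) fun a _ => ?_).trans (by simp)
    cases M.step v a with
    | none => simp
    | some y => have := h y; simp; omega
  have h2 : Fintype.card α < 2 ^ Fintype.card α := Nat.lt_two_pow_self
  have h3 : 0 < 2 ^ m := by positivity
  calc M.succSum g v ≤ Fintype.card α * (2 ^ m - 1) := h1
    _ ≤ Fintype.card α * 2 ^ m := Nat.mul_le_mul_left _ (Nat.sub_le _ _)
    _ < 2 ^ Fintype.card α * 2 ^ m := Nat.mul_lt_mul_of_pos_right h2 h3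
    _ = 2 ^ (m + Fintype.card α) := by rw [pow_add, mul_comm]

theorem hitCount_lt [Fintype α] (n : ℕ) (v : V) :
    M.hitCount T n v < 2 ^ (n * Fintype.card α + 1) := by
  induction n generalizing v with
  | zero => simp [hitCount]
  | succ n ih =>
    simp only [hitCount]
    cases M.final v with
    | true =>
      refine (Nat.lt_of_le_of_lt (Bool.toNat_le _) (Nat.one_lt_two_pow (by omega)))
    | false =>
      refine (succSum_lt ih v).trans_le (le_of_eq ?_)
      ring

/-! #### Infinitely many children -/

variable (M T) in
/-- The total automaton that accepts `hitSet`; the state `none` is a sink. -/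
def hitDFA (v : V) : DFA α (Option V) where
  step s a := s.bind fun x => bif M.final x then none else M.step x a
  start := some v
  accept := {s | ∃ x, s = some x ∧ M.final x = true ∧ T x = true}

theorem mem_hitDFA_accepts : w ∈ (M.hitDFA T v).accepts ↔ w ∈ M.hitSet T v := by
  have h0 : ∀ w, (M.hitDFA T v).evalFrom none w = none := by
    intro w
    induction w with
    | nil => rfl
    | cons a w ih => exact ih
  have h : ∀ w x, (M.hitDFA T v).evalFrom (some x) w ∈ (M.hitDFA T v).accept ↔
      w ∈ M.hitSet T x := by
    intro w
    induction w with
    | nil => intro x; simp [nil_mem_hitSet, hitDFA]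
    | cons a w ih =>
      intro x
      have hs : (M.hitDFA T v).step (some x) a = bif M.final x then none else M.step x a := rfl
      have hn : none ∉ (M.hitDFA T v).accept := by simp [hitDFA]
      rw [DFA.evalFrom_cons, hs, cons_mem_hitSet]
      cases hx : M.final x
      · cases hy : M.step x a
        · simp [h0, hn]
        · simp [ih]
      · simp [h0, hn]
  exact h w v

/-- A word longer than the number of states can be pumped up and down. -/
theorem hitSet_pump [Fintype V] (hw : w ∈ M.hitSet T v) (hl : Fintype.card V + 1 ≤ w.length) :
    ∃ a b c, w = a ++ b ++ c ∧ b.length ≤ Fintype.card V + 1 ∧ b ≠ [] ∧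
      ∀ n, a ++ (List.replicate n b).flatten ++ c ∈ M.hitSet T v := by
  obtain ⟨a, b, c, e, h1, h2, h3⟩ := DFA.pumping_lemma (M := M.hitDFA T v)
    (mem_hitDFA_accepts.2 hw) (by simpa using hl)
  refine ⟨a, b, c, e, ?_, h2, fun n => mem_hitDFA_accepts.1 (h3 ?_)⟩
  · rw [Fintype.card_option] at h1
    omega
  · refine Language.mem_mul.2 ⟨_, Language.mem_mul.2 ⟨a, rfl, _, ?_, rfl⟩, c, rfl, rfl⟩
    exact Language.mem_kstar.2 ⟨_, rfl, fun y hy => List.eq_of_mem_replicate hy⟩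

theorem hitSet_infinite [Fintype V] (hw : w ∈ M.hitSet T v)
    (hl : Fintype.card V + 1 ≤ w.length) : (M.hitSet T v).Infinite := by
  obtain ⟨a, b, c, -, -, hb, h⟩ := hitSet_pump hw hl
  refine Set.infinite_of_injective_forall_mem (fun m n e => ?_) h
  have := List.length_pos_iff.2 hb
  have e' := congrArg List.length e
  simp only [List.length_append, List.length_flatten, List.map_replicate, List.sum_replicate,
    smul_eq_mul] at e'
  exact Nat.eq_of_mul_eq_mul_right this (by omega)

/-- Pumping down shortens a word by at most `N + 1` letters, so it cannot skip the lengths from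
`N + 1` to `2 * N + 1`. -/
theorem hitSet_exists_medium [Fintype V] (hw : w ∈ M.hitSet T v)
    (hl : Fintype.card V + 1 ≤ w.length) :
    ∃ u ∈ M.hitSet T v, Fintype.card V + 1 ≤ u.length ∧ u.length < 2 * Fintype.card V + 2 := by
  induction hn : w.length using Nat.strong_induction_on generalizing w with
  | _ n ih =>
    by_cases hlt : w.length < 2 * Fintype.card V + 2
    · exact ⟨w, hw, hl, hlt⟩
    · obtain ⟨a, b, c, rfl, h1, hb, h⟩ := hitSet_pump hw hl
      have h0 := h 0
      have := List.length_pos_iff.2 hb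
      simp only [List.replicate_zero, List.flatten_nil, List.append_nil] at h0
      simp only [List.length_append] at hn hlt
      exact ih _ (by rw [List.length_append]; omega) h0 (by rw [List.length_append]; omega) rfl

/-- Let `N` be the number of states. There are infinitely many children of some kind if and only if
there is one whose length is between `N + 2` and `2 * N + 2`; otherwise there are only children of
length at most `N + 1`. -/
theorem encard_childSet [Fintype V] [Fintype α] (v : V) :
    (M.childSet (fun p => T p = true) v).encard =
      if M.succSum (M.hitCount T (Fintype.card V + 1)) v =
        M.succSum (M.hitCount T (2 * Fintype.card V + 2)) v
      then (M.succSum (M.hitCount T (Fintype.card V + 1)) v : ℕ∞) else ⊤ := by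
  have h1 := encard_childSet_lt (M := M) (T := T) (Fintype.card V + 1) v
  have h2 := encard_childSet_lt (M := M) (T := T) (2 * Fintype.card V + 2) v
  set A := M.childSet (fun p => T p = true) v with hA
  have hsub : {w | w ∈ A ∧ w.length < Fintype.card V + 1 + 1} ⊆
      {w | w ∈ A ∧ w.length < 2 * Fintype.card V + 2 + 1} := fun w hw => ⟨hw.1, by
    have := hw.2
    omega⟩
  by_cases h : ∃ w ∈ A, Fintype.card V + 1 + 1 ≤ w.length
  · obtain ⟨w, hw, hl⟩ := h
    cases w with
    | nil => simp at hl
    | cons a w =>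
      obtain ⟨y, hy, hw⟩ := cons_mem_childSet.1 hw
      have hl : Fintype.card V + 1 ≤ w.length := by simpa using hl
      rw [if_neg]
      · rw [Set.encard_eq_top_iff]
        have h3 := (hitSet_infinite hw hl).image (f := (a :: ·)) List.cons_injective.injOn
        refine h3.mono ?_
        rintro _ ⟨u, hu, rfl⟩
        exact cons_mem_childSet.2 ⟨y, hy, hu⟩
      · intro e
        rw [← e, ← h1] at h2
        obtain ⟨u, hu, hu1, hu2⟩ := hitSet_exists_medium hw hl
        have hfin : {w | w ∈ A ∧ w.length < Fintype.card V + 1 + 1}.Finite :=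
          Set.encard_lt_top_iff.1 (by rw [h1]; exact ENat.natCast_lt_top _)
        have h4 := hfin.eq_of_subset_of_encard_le hsub h2.le
        have h5 : a :: u ∈ {w | w ∈ A ∧ w.length < 2 * Fintype.card V + 2 + 1} :=
          ⟨cons_mem_childSet.2 ⟨y, hy, hu⟩, by simp only [List.length_cons]; omega⟩
        rw [← h4] at h5
        have := h5.2
        simp only [List.length_cons] at this
        omega
  · push Not at h
    have h3 : {w | w ∈ A ∧ w.length < Fintype.card V + 1 + 1} = A :=
      Set.ext fun w => ⟨fun hw => hw.1, fun hw => ⟨hw, h w hw⟩⟩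
    have h4 : {w | w ∈ A ∧ w.length < 2 * Fintype.card V + 2 + 1} = A :=
      Set.Subset.antisymm (fun w hw => hw.1) (h3.symm.subset.trans hsub)
    rw [h3] at h1
    rw [h4, h1] at h2
    rw [if_pos (by exact_mod_cast h2), h1]

end PartialAutomaton

end RegularTree

/-! ### Correctness of the algorithm -/

namespace RegularTree

theorem getD_map_range {β : Type} (f : ℕ → β) {n i : ℕ} (d : β) (h : i < n) :
    ((List.range n).map f).getD i d = f i := by
  simp [List.getD_eq_getElem?_getD, h]

/-- The lists `fl` and `rows` describe the automaton `M`, whose states are numbered by `idx`. A row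
lists the successors of a state; all that matters is what sums over its entries amount to, so the
letters need not be numbered, and undefined transitions may be left out. -/
structure Represents {V α : Type} [Fintype V] [Fintype α] (M : PartialAutomaton V α) (idx : V → ℕ)
    (fl : List Bool) (rows : List (List ℕ)) : Prop where
  card : Fintype.card V = rows.length
  lt : ∀ v, idx v < rows.length
  surj : ∀ i < rows.length, ∃ v, idx v = i
  flag : ∀ v, fl.getD (idx v) false = M.final v
  row : ∀ v, ∃ l : List (Option V),
    rows.getD (idx v) [] = l.map (fun o => (o.map fun y => idx y + 1).getD 0) ∧
      ∀ g : V → ℕ, (l.map fun o => (o.map g).getD 0).sum = M.succSum g v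

namespace Represents

variable {V α : Type} [Fintype V] [Fintype α] {M : PartialAutomaton V α} {idx : V → ℕ}
  {fl : List Bool} {rows : List (List ℕ)} {L : ℕ}

theorem sumRow_eq (h : Represents M idx fl rows) {G : List (List Bool)} {g : V → ℕ}
    (hG : ∀ y, G.getD (idx y) (unitBits L false) = bitsOf (L + 1) (g y)) (v : V) :
    sumRow L G (rows.getD (idx v) []) = bitsOf (L + 1) (M.succSum g v) := by
  obtain ⟨l, e, hl⟩ := h.row v
  rw [e, ← hl g]
  clear e hl
  unfold sumRow
  induction l using List.reverseRecOn with
  | nil => exact unitBits_eq L false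
  | append_singleton l o ih =>
    rw [List.map_append, List.foldl_append, ih]
    cases o with
    | none => simp [unitBits_eq, addBits_bitsOf]
    | some y =>
      have hy := hG y
      simp only [List.map_cons, List.map_nil, Option.map_some, Option.getD_some, List.foldl_cons,
        List.foldl_nil, List.getD_cons_succ, hy, addBits_bitsOf, List.map_append, List.sum_append,
        List.sum_cons, List.sum_nil, add_zero]

theorem countTable_eq (h : Represents M idx fl rows) {T : List Bool} {T' : V → Bool}
    (hT : ∀ v, T.getD (idx v) false = T' v) (n : ℕ) (v : V) :
    (countTable L fl rows T n).getD (idx v) (unitBits L false) =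
      bitsOf (L + 1) (M.hitCount T' n v) := by
  induction n generalizing v with
  | zero => exact unitBits_eq L false
  | succ n ih =>
    have e : countTable L fl rows T (n + 1) =
        countStep L fl rows T (countTable L fl rows T n) := Function.iterate_succ_apply' _ _ _
    rw [e, countStep, getD_map_range _ _ (h.lt v), h.flag, hT, h.sumRow_eq ih]
    simp only [PartialAutomaton.hitCount]
    cases M.final v
    · rfl
    · exact unitBits_eq L _

theorem signature_eq_iff (h : Represents M idx fl rows)
    (hL : Fintype.card α * (2 * Fintype.card V + 3) ≤ L) {T : List Bool} {T' : V → Bool}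
    (hT : ∀ v, T.getD (idx v) false = T' v) (v v' : V) :
    (signature L fl rows T).getD (idx v) [] = (signature L fl rows T).getD (idx v') [] ↔
      (M.childSet (fun p => T' p = true) v).encard =
        (M.childSet (fun p => T' p = true) v').encard := by
  have hlt : ∀ n ≤ 2 * Fintype.card V + 2, ∀ v,
      M.succSum (M.hitCount T' n) v < 2 ^ (L + 1) := fun n hn v => by
    refine (PartialAutomaton.succSum_lt (PartialAutomaton.hitCount_lt n) v).trans_le
      (Nat.pow_le_pow_right (by norm_num) ?_)
    have := Nat.mul_le_mul_right (Fintype.card α) hn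
    linarith
  have key : ∀ v, (signature L fl rows T).getD (idx v) [] =
      if M.succSum (M.hitCount T' (Fintype.card V + 1)) v =
        M.succSum (M.hitCount T' (2 * Fintype.card V + 2)) v
      then bitsOf (L + 1) (M.succSum (M.hitCount T' (Fintype.card V + 1)) v) else [] := by
    intro v
    rw [signature, getD_map_range _ _ (h.lt v), ← h.card, h.sumRow_eq (h.countTable_eq hT _),
      h.sumRow_eq (h.countTable_eq hT _)]
    split_ifs with e
    · rw [← e, eqBits_iff.2 rfl, cond_true]
    · have : eqBits (bitsOf (L + 1) (M.succSum (M.hitCount T' (Fintype.card V + 1)) v))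
          (bitsOf (L + 1) (M.succSum (M.hitCount T' (2 * Fintype.card V + 2)) v)) = false := by
        rw [← Bool.not_eq_true, eqBits_iff]
        exact fun e' => e (bitsOf_injOn (hlt _ (by omega) v) (hlt _ (by omega) v) e')
      rw [this, cond_false]
  rw [key, key, PartialAutomaton.encard_childSet, PartialAutomaton.encard_childSet]
  have hne : ∀ n, bitsOf (L + 1) n ≠ [] := fun n => by simp [bitsOf]
  split_ifs
  · rw [Nat.cast_inj]
    exact ⟨bitsOf_injOn (hlt _ (by omega) v) (hlt _ (by omega) v'), fun e => by rw [e]⟩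
  · simp [hne]
  · simp [(hne _).symm]
  · simp

/-- The matrix `E` describes the relation `R` on the states. -/
def IsMatrix (idx : V → ℕ) (rows : List (List ℕ)) (E : List (List Bool)) (R : V → V → Prop) :
    Prop :=
  E.length = rows.length ∧ ∀ v v', (E.getD (idx v) []).getD (idx v') false = true ↔ R v v'

theorem refineStep_isMatrix (h : Represents M idx fl rows)
    (hL : Fintype.card α * (2 * Fintype.card V + 3) ≤ L) {E : List (List Bool)} {R : V → V → Prop}
    (hE : IsMatrix idx rows E R) :
    IsMatrix idx rows (refineStep L fl rows E) fun v v' => R v v' ∧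
      ∀ p, (M.childSet (R p) v).encard = (M.childSet (R p) v').encard := by
  classical
  refine ⟨by simp [refineStep], fun v v' => ?_⟩
  have hsig : ∀ p, eqBits ((signature L fl rows (E.getD (idx p) [])).getD (idx v) [])
      ((signature L fl rows (E.getD (idx p) [])).getD (idx v') []) = true ↔
      (M.childSet (R p) v).encard = (M.childSet (R p) v').encard := fun p => by
    rw [eqBits_iff, h.signature_eq_iff hL (T' := fun q => decide (R p q)) fun q => by
      rw [Bool.eq_iff_iff, hE.2, decide_eq_true_iff]]
    simp only [decide_eq_true_iff]
  have hmem : ∀ r ∈ E, ∃ p, r = E.getD (idx p) [] := fun r hr => by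
    obtain ⟨i, hi, rfl⟩ := List.mem_iff_getElem.1 hr
    obtain ⟨p, rfl⟩ := h.surj i (hE.1 ▸ hi)
    exact ⟨p, by simp [List.getD_eq_getElem?_getD, hi]⟩
  have hmem' : ∀ p, E.getD (idx p) [] ∈ E := fun p => by
    have hi : idx p < E.length := hE.1 ▸ h.lt p
    rw [List.getD_eq_getElem?_getD, List.getElem?_eq_getElem hi]
    exact List.getElem_mem hi
  rw [refineStep, getD_map_range _ _ (h.lt v), getD_map_range _ _ (h.lt v'), Bool.and_eq_true,
    hE.2, List.all_eq_true]
  refine and_congr_right fun _ => ⟨fun H p => ?_, fun H s hs => ?_⟩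
  · exact (hsig p).1 (H _ (List.mem_map_of_mem (hmem' p)))
  · obtain ⟨r, hr, rfl⟩ := List.mem_map.1 hs
    obtain ⟨p, rfl⟩ := hmem r hr
    exact (hsig p).2 (H p)

theorem stablePartition_iff (h : Represents M idx fl rows)
    (hL : Fintype.card α * (2 * Fintype.card V + 3) ≤ L) (v v' : V) :
    ((stablePartition L fl rows).getD (idx v) []).getD (idx v') false = true ↔
      M.refinement (Fintype.card V * Fintype.card V) v v' := by
  have key : ∀ n, IsMatrix idx rows ((refineStep L fl rows)^[n]
      ((List.range rows.length).map fun _ => (List.range rows.length).map fun _ => true))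
      (M.refinement n) := by
    intro n
    induction n with
    | zero =>
      refine ⟨by simp, fun v v' => ?_⟩
      rw [Function.iterate_zero_apply, getD_map_range _ _ (h.lt v), getD_map_range _ _ (h.lt v')]
      simp [PartialAutomaton.refinement]
    | succ n ih =>
      rw [Function.iterate_succ_apply']
      exact h.refineStep_isMatrix hL ih
  rw [stablePartition, h.card]
  exact (key _).2 v v'

end Represents

/-! ### The disjoint union of two automata -/

/-- The disjoint union of two automata, over the disjoint union of their alphabets. -/
def union (A B : PartialDFA) :
    PartialAutomaton (Fin A.numStates ⊕ Fin B.numStates) (Fin A.numSymbols ⊕ Fin B.numSymbols) where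
  step
    | .inl q, .inl a => (A.step q a).map .inl
    | .inr q, .inr a => (B.step q a).map .inr
    | _, _ => none
  final
    | .inl q => decide (q ∈ A.accept)
    | .inr q => decide (q ∈ B.accept)

theorem map_prefix_map_iff {β γ : Type} {f : β → γ} (hf : Function.Injective f) {u w : List β} :
    u.map f <+: w.map f ↔ u <+: w := by
  refine ⟨fun ⟨t, e⟩ => ?_, fun h => h.map f⟩
  obtain ⟨x, y, rfl, h1, -⟩ := List.map_eq_append_iff.1 e.symm
  rw [← hf.list_map h1]
  exact List.prefix_append _ _

/-- If an automaton `A` is embedded into `M`, and no further letters can be read in the image, then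
`A` accepts the same tree as `M` does from the image of the initial state. -/
theorem nonempty_relIso_of_embedding {V α : Type} {A : PartialDFA} {M : PartialAutomaton V α}
    (φ : Fin A.numStates → V) (ψ : Fin A.numSymbols → α) (hψ : Function.Injective ψ)
    (hstep : ∀ q a, M.step (φ q) (ψ a) = (A.step q a).map φ)
    (hnone : ∀ q b, b ∉ Set.range ψ → M.step (φ q) b = none)
    (hfinal : ∀ q, M.final (φ q) = decide (q ∈ A.accept)) :
    Nonempty (A.prefixOrder ≃r prefixRel (M.lang (φ A.start))) := by
  have h1 : ∀ w q, M.eval (φ q) (w.map ψ) = (A.evalFrom q w).map φ := by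
    intro w
    induction w with
    | nil => intro q; rfl
    | cons a w ih =>
      intro q
      rw [List.map_cons, PartialAutomaton.eval, hstep, PartialDFA.evalFrom]
      cases A.step q a with
      | none => rfl
      | some p => exact ih p
  have h2 : ∀ w q s, M.eval (φ q) w = some s → ∃ u : List (Fin A.numSymbols), w = u.map ψ := by
    intro w
    induction w with
    | nil => exact fun _ _ _ => ⟨[], rfl⟩
    | cons b w ih =>
      intro q s h
      by_cases hb : b ∈ Set.range ψ
      · obtain ⟨a, rfl⟩ := hb
        rw [PartialAutomaton.eval, hstep] at h
        cases hq : A.step q a with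
        | none => simp [hq] at h
        | some p =>
          obtain ⟨u, rfl⟩ := ih p s (by simpa [hq] using h)
          exact ⟨a :: u, rfl⟩
      · simp [PartialAutomaton.eval, hnone q b hb] at h
  refine nonempty_relIso_of_rel (S := {w | w ∈ A.language}) (fun w w' => w' = w.map ψ) ?_ ?_ ?_
  · rintro w ⟨q, hq, e⟩
    exact ⟨_, ⟨φ q, by rw [h1, e]; rfl, by simpa [hfinal] using hq⟩, rfl⟩
  · rintro w' ⟨s, e, hs⟩
    obtain ⟨w, rfl⟩ := h2 _ _ _ e
    rw [h1] at e
    obtain ⟨q, hq, rfl⟩ := Option.map_eq_some_iff.1 e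
    exact ⟨w, ⟨q, by simpa [hfinal] using hs, hq⟩, rfl⟩
  · rintro u _ w _ rfl rfl
    exact (map_prefix_map_iff hψ).symm

variable {A B : PartialDFA}

theorem prefixIso_iff_treeIso :
    A.PrefixIso B ↔ (union A B).TreeIso (.inl A.start) (.inr B.start) := by
  obtain ⟨e⟩ := nonempty_relIso_of_embedding (A := A) (M := union A B) .inl .inl Sum.inl_injective
    (fun _ _ => rfl) (fun q b hb => by cases b <;> simp_all [union]) fun _ => rfl
  obtain ⟨e'⟩ := nonempty_relIso_of_embedding (A := B) (M := union A B) .inr .inr Sum.inr_injective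
    (fun _ _ => rfl) (fun q b hb => by cases b <;> simp_all [union]) fun _ => rfl
  exact ⟨fun ⟨f⟩ => ⟨(e.symm.trans f).trans e'⟩, fun ⟨f⟩ => ⟨(e.trans f).trans e'.symm⟩⟩

end RegularTree

/-! ### Reading the description of two automata -/

namespace RegularTree

theorem getD_flatMap_finRange {n k : ℕ} (f : Fin n → List ℕ) (hk : ∀ q, (f q).length = k)
    (q : Fin n) {a : ℕ} (ha : a < k) (t : List ℕ) :
    ((List.finRange n).flatMap f ++ t).getD (q * k + a) 0 = (f q).getD a 0 := by
  induction n with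
  | zero => exact q.elim0
  | succ n ih =>
    rw [List.finRange_succ, List.flatMap_cons, List.flatMap_map, List.append_assoc]
    refine Fin.cases ?_ (fun q => ?_) q
    · rw [List.getD_append _ _ _ _ (by simp [hk, ha])]
      simp
    · have h := ih (fun q => f q.succ) (fun q => hk _) q
      rw [List.getD_append_right _ _ _ _ (by rw [hk, Fin.val_succ]; nlinarith), hk, ← h]
      congr 1
      rw [Fin.val_succ, add_mul, one_mul]
      omega

namespace PartialDFA

variable (A : PartialDFA) (p t : List ℕ)

theorem getD_append_toNats (i : ℕ) :
    (p ++ (A.toNats ++ t)).getD (p.length + i) 0 = (A.toNats ++ t).getD i 0 := by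
  rw [List.getD_append_right _ _ _ _ (by omega)]
  congr 1
  omega

theorem getD_toNats_flag (q : Fin A.numStates) :
    (A.toNats ++ t).getD (3 + q) 0 = if q ∈ A.accept then 1 else 0 := by
  rw [add_comm]
  simp only [toNats, List.cons_append, List.getD_cons_succ, List.append_assoc]
  rw [List.getD_append _ _ _ _ (by simp)]
  simp [List.getD_eq_getElem?_getD]

theorem getD_toNats_entry (q : Fin A.numStates) (a : Fin A.numSymbols) :
    (A.toNats ++ t).getD (3 + (A.numStates + (q * A.numSymbols + a))) 0 = entry (A.step q a) := by
  rw [add_comm]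
  simp only [toNats, List.cons_append, List.getD_cons_succ, List.append_assoc]
  rw [List.getD_append_right _ _ _ _ (by simp)]
  simp only [List.length_map, List.length_finRange, Nat.add_sub_cancel_left]
  rw [getD_flatMap_finRange _ (fun q => by simp) q a.isLt]
  simp [List.getD_eq_getElem?_getD]

theorem length_toNats : A.toNats.length = 3 + (A.numStates + A.numStates * A.numSymbols) := by
  simp [toNats, List.length_flatMap]
  omega

theorem flagsAt_eq : flagsAt (p ++ (A.toNats ++ t)) p.length =
    (List.finRange A.numStates).map fun q => decide (q ∈ A.accept) := by
  have h := getD_append_toNats A p t 0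
  rw [add_zero] at h
  rw [flagsAt, h, show (A.toNats ++ t).getD 0 0 = A.numStates from rfl,
    ← List.map_coe_finRange_eq_range, List.map_map]
  refine List.map_congr_left fun q _ => ?_
  simp only [Function.comp_apply, getD_append_toNats, getD_toNats_flag]
  split_ifs with h <;> simp [h]

theorem rowsAt_eq (d : ℕ) : rowsAt (p ++ (A.toNats ++ t)) p.length d =
    (List.finRange A.numStates).map fun q => (List.finRange A.numSymbols).map fun a =>
      ((A.step q a).map fun y => d + y.val + 1).getD 0 := by
  have h := getD_append_toNats A p t 0
  rw [add_zero] at h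
  rw [rowsAt, h, getD_append_toNats, show (A.toNats ++ t).getD 0 0 = A.numStates from rfl,
    show (A.toNats ++ t).getD 1 0 = A.numSymbols from rfl,
    ← List.map_coe_finRange_eq_range (n := A.numStates), List.map_map]
  refine List.map_congr_left fun q _ => ?_
  rw [Function.comp_apply, ← List.map_coe_finRange_eq_range, List.map_map]
  refine List.map_congr_left fun a _ => ?_
  rw [Function.comp_apply, getD_append_toNats, getD_toNats_entry]
  cases A.step q a with
  | none => rfl
  | some y => simp [entry]; omega

end PartialDFA

/-- The numbering of the states of the union: those of `A`, followed by those of `B`. -/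
def unionIdx (A B : PartialDFA) : Fin A.numStates ⊕ Fin B.numStates → ℕ
  | .inl q => q
  | .inr q => A.numStates + q

variable (A B : PartialDFA)

theorem getD_append_finRange {β : Type} {m n : ℕ} (f : Fin m → β) (g : Fin n → β) (d : β) :
    (∀ q : Fin m, ((List.finRange m).map f ++ (List.finRange n).map g).getD q d = f q) ∧
    ∀ q : Fin n, ((List.finRange m).map f ++ (List.finRange n).map g).getD (m + q) d = g q := by
  refine ⟨fun q => ?_, fun q => ?_⟩
  · rw [List.getD_append _ _ _ _ (by simp)]
    simp [List.getD_eq_getElem?_getD]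
  · rw [List.getD_append_right _ _ _ _ (by simp)]
    simp [List.getD_eq_getElem?_getD]

theorem represents_union :
    Represents (union A B) (unionIdx A B)
      ((List.finRange A.numStates).map (fun q => decide (q ∈ A.accept)) ++
        (List.finRange B.numStates).map fun q => decide (q ∈ B.accept))
      (((List.finRange A.numStates).map fun q => (List.finRange A.numSymbols).map fun a =>
          ((A.step q a).map fun y => 0 + y.val + 1).getD 0) ++
        (List.finRange B.numStates).map fun q => (List.finRange B.numSymbols).map fun a =>
          ((B.step q a).map fun y => A.numStates + y.val + 1).getD 0) where
  card := by simp
  lt v := by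
    rcases v with q | q
    · have := q.isLt
      simp [unionIdx]; omega
    · simp [unionIdx]
  surj i hi := by
    simp only [List.length_append, List.length_map, List.length_finRange] at hi
    by_cases h : i < A.numStates
    · exact ⟨.inl ⟨i, h⟩, rfl⟩
    · exact ⟨.inr ⟨i - A.numStates, by omega⟩, by simp [unionIdx]; omega⟩
  flag v := by
    rcases v with q | q
    · exact (getD_append_finRange _ _ _).1 q
    · exact (getD_append_finRange _ _ _).2 q
  row v := by
    rcases v with q | q
    · refine ⟨(List.finRange A.numSymbols).map fun a => (A.step q a).map .inl,
        ((getD_append_finRange _ _ _).1 q).trans ?_, fun g => ?_⟩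
      · simp [Function.comp_def, unionIdx]
      · simp [PartialAutomaton.succSum, union, ← Fin.sum_univ_def, Function.comp_def]
    · refine ⟨(List.finRange B.numSymbols).map fun a => (B.step q a).map .inr,
        ((getD_append_finRange _ _ _).2 q).trans ?_, fun g => ?_⟩
      · simp [Function.comp_def, unionIdx]
      · simp [PartialAutomaton.succSum, union, ← Fin.sum_univ_def, Function.comp_def]

/-- The decision procedure is correct. That both automata accept the empty word means that both
initial states are final, so that the criterion for final states applies. -/
theorem decideIsoNats_iff (hA : [] ∈ A.language) (hB : [] ∈ B.language) :
    decideIsoNats (A.toNats ++ B.toNats) = true ↔ A.PrefixIso B := by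
  have hA' : (union A B).final (.inl A.start) = true := by
    obtain ⟨q, hq, e⟩ := hA
    obtain rfl : A.start = q := Option.some.inj e
    simpa [union] using hq
  have hB' : (union A B).final (.inr B.start) = true := by
    obtain ⟨q, hq, e⟩ := hB
    obtain rfl : B.start = q := Option.some.inj e
    simpa [union] using hq
  have hs : secondAt (A.toNats ++ B.toNats) = A.toNats.length := A.length_toNats.symm
  have hget : ∀ i, (A.toNats ++ B.toNats).getD (A.toNats.length + i) 0 = B.toNats.getD i 0 := by
    intro i
    simpa using B.getD_append_toNats A.toNats [] i
  have h0 := hget 0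
  rw [add_zero] at h0
  have e1 := A.flagsAt_eq [] B.toNats
  have e2 := A.rowsAt_eq [] B.toNats 0
  have e3 := B.flagsAt_eq A.toNats []
  have e4 := B.rowsAt_eq A.toNats [] A.numStates
  simp only [List.nil_append, List.length_nil, List.append_nil] at e1 e2 e3 e4
  have g0 : (A.toNats ++ B.toNats).getD 0 0 = A.numStates := rfl
  have g1 : (A.toNats ++ B.toNats).getD 1 0 = A.numSymbols := rfl
  have g2 : (A.toNats ++ B.toNats).getD 2 0 = unionIdx A B (.inl A.start) := rfl
  have g3 : A.numStates + B.toNats.getD 2 0 = unionIdx A B (.inr B.start) := rfl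
  rw [decideIsoNats, bitLength, hs, e3, g0, g1, g2, e1, e2, e4, h0, hget, hget, g3,
    (represents_union A B).stablePartition_iff ?_, prefixIso_iff_treeIso,
    PartialAutomaton.treeIso_iff_refinement hA' hB']
  have g4 : B.toNats.getD 0 0 = B.numStates := rfl
  have g5 : B.toNats.getD 1 0 = B.numSymbols := rfl
  rw [g4, g5]
  simp

end RegularTree

theorem mainTheorem5 :
    RegularTree.SolvableInPolyTime RegularTree.Instance.encode
      (fun x : RegularTree.Instance => x.1.1.PrefixIso x.1.2) := by
  refine RegularTree.solvableInPolyTime_of_polyTime RegularTree.polyTime_decideIso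
    fun x => ?_
  rw [RegularTree.decideIso, RegularTree.Instance.encode, RegularTree.bitsToNats_natsToBits]
  exact RegularTree.decideIsoNats_iff x.1.1 x.1.2 x.2.1 x.2.2
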